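/- **Setting.** A *type domain* $\mathfrak D$ is a finite set of pairwise disjoint data types, each with a nonempty value domain and finitely many predicates; for every type there are countably many normal variables, and, if its value domain is countably infinite, also countably many fresh variables. A *$\nu$-CPN* has finitely many places, each coloured by a tuple of types, and finitely many transitions, with: input arcs carrying multisets of tuples of normal variables; read arcs, whose inscriptions must each match a present token that is not consumed; quantifier- and relation-free guards; output arcs carrying multisets of tuples of normal variables, fresh variables and values. A transition is enabled under a binding of its variables if the input and read tokens are present, the guard holds, and its fresh variables get pairwise distinct values that do not occur in the marking; variables that are neither input nor fresh get arbitrary values of their type. In a $\nu$-CPN *with transition priorities* an enabled transition may fire only if no transition of higher priority is enabled. A *DB-net* $\mathcal B=\langle\mathfrak D,\mathcal P,\mathcal L,\mathcal N\rangle$ consists of a persistence layer $\mathcal P$ (a finite relational schema $\mathcal R$ and a finite set of boolean first-order constraints), a data logic layer $\mathcal L$ (finitely many first-order queries under active-domain semantics, and finitely many parameterized actions, each deleting and then adding finitely many facts) and a control layer $\mathcal N$: a $\nu$-CPN with transition set $T$ whose places are the control places $P_c$, together with view places that are assigned queries and are read by transitions, a partial assignment of actions with inscriptions to transitions, and a rollback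 flow. A *snapshot* is a pair $\langle\mathcal I,m\rangle$ of a finite database instance satisfying the constraints and a marking $m$ of $P_c$; a view place always contains the set of answers to its query in $\mathcal I$. A transition fires by consuming its input tokens, reading view answers, giving to fresh variables pairwise distinct values that do not occur in $\mathcal I$ or $m$, and applying its action; if the resulting instance satisfies the constraints, the update is kept and the normal output is produced, otherwise the instance is unchanged and the rollback output is produced. $\Gamma^{\mathcal B}_{s_0}$ is the resulting transition system with initial snapshot $s_0$; a step is labelled by the transition $t\in T$ that fires. A query is in $\mathrm{UCQF}^{\neq}$ if it is a finite disjunction of formulas $\exists\vec y.\,\mathit{conj}$, where $\mathit{conj}$ is a conjunction of relation atoms, predicate atoms and negated predicate atoms. **Theorem.** Let $\mathcal B$ be a DB-net whose set of constraints is empty and all of whose queries are in $\mathrm{UCQF}^{\neq}$, and let $s_0$ be a snapshot of $\mathcal B$. Then there is a $\nu$-CPN $N$ over $\mathfrak D$ with transition priorities and an initial marking $M_0$ such that: 1. the places of $N$ are the control places $P_c$ with their colours, one relation place for each relation of $\mathcal R$, whose colour is the signature of the relation, and a finite set of auxiliary places; 2. the transitions of $N$ are finitely many visible ones and finitely many auxiliary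 ones; each visible transition is a copy of, and is labelled by, a transition $t\in T$, each $t\in T$ has at least one copy, and auxiliary transitions are labelled by the silent label $\epsilon$; 3. with this labelling, there is a weak bisimulation $wb$ between $\Gamma^{\mathcal B}_{s_0}$ and the transition system $\Gamma^{N}_{M_0}$ of $N$ with $\langle s_0,M_0\rangle\in wb$, such that, for every $\langle\langle\mathcal I,m\rangle,M\rangle\in wb$, $M$ coincides with $m$ on $P_c$, and the content of each relation place in $M$ is exactly the set of facts of that relation in $\mathcal I$, each with multiplicity one. Here $wb$ is a weak bisimulation if, whenever $\langle p,q\rangle\in wb$, every step $p\xrightarrow{a}p'$, where $a$ is a label or $\epsilon$, is matched by some $q'$ with $q\,(\xrightarrow{\epsilon})^*\xrightarrow{a}(\xrightarrow{\epsilon})^*\,q'$ (for $a=\epsilon$: $q\,(\xrightarrow{\epsilon})^*\,q'$) and $\langle p',q'\rangle\in wb$, and symmetrically. -/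

import Mathlib

universe u

/-! ## Type domains, variables, terms, tuples -/

/-- A type domain: finitely many data types, each with a value domain and finitely many
interpreted predicate symbols. Value domains are nonempty; distinct data types are disjoint
because values are tagged by their type. -/
structure TypeDomain where
  Ty : Type
  Dom : Ty → Type u
  Pred : Ty → Type
  arity : {τ : Ty} → Pred τ → ℕ
  interp : {τ : Ty} → (S : Pred τ) → (Fin (arity S) → Dom τ) → Prop
  finite_ty : Finite Ty
  finite_pred : ∀ τ, Finite (Pred τ)
  nonempty_dom : ∀ τ, Nonempty (Dom τ)

namespace TypeDomain

/-- A color `D₁ × ⋯ × Dₘ`. -/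
abbrev Color (𝔇 : TypeDomain.{u}) : Type := List 𝔇.Ty

/-- A tuple of values of a given color. -/
abbrev Tuple (𝔇 : TypeDomain.{u}) (c : 𝔇.Color) : Type u :=
  (i : Fin c.length) → 𝔇.Dom (c.get i)

/-- The value `o` of type `τ` is a component of the tuple `a`. -/
def Occurs (𝔇 : TypeDomain.{u}) {c : 𝔇.Color} (a : 𝔇.Tuple c) (τ : 𝔇.Ty) (o : 𝔇.Dom τ) : Prop :=
  ∃ i, (⟨c.get i, a i⟩ : Σ τ, 𝔇.Dom τ) = ⟨τ, o⟩

/-- Normal variables: countably many, named by natural numbers, for each data type. -/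
abbrev NVar (𝔇 : TypeDomain.{u}) (_τ : 𝔇.Ty) : Type := ℕ

/-- Normal and fresh variables. Fresh variables exist only for data types with a countably
infinite value domain. -/
inductive XVar (𝔇 : TypeDomain.{u}) (τ : 𝔇.Ty) : Type
  | normal (n : ℕ) : XVar 𝔇 τ
  | fresh (n : ℕ) (h : Countable (𝔇.Dom τ) ∧ Infinite (𝔇.Dom τ)) : XVar 𝔇 τ

/-- A term of type `τ`: a variable from the family `V`, or a value. -/
inductive Term (𝔇 : TypeDomain.{u}) (V : 𝔇.Ty → Type) (τ : 𝔇.Ty) : Type u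
  | var (x : V τ) : Term 𝔇 V τ
  | val (o : 𝔇.Dom τ) : Term 𝔇 V τ

/-- Well-typed assignments of values to the variables of the family `V`. -/
abbrev Assignment (𝔇 : TypeDomain.{u}) (V : 𝔇.Ty → Type) : Type u :=
  (τ : 𝔇.Ty) → V τ → 𝔇.Dom τ

/-- A binding gives values to normal and fresh variables. -/
abbrev Binding (𝔇 : TypeDomain.{u}) : Type u := 𝔇.Assignment 𝔇.XVar

/-- The part of a binding that concerns normal variables. -/
def Binding.onNormal {𝔇 : TypeDomain.{u}} (σ : 𝔇.Binding) : 𝔇.Assignment 𝔇.NVar :=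
  fun τ n => σ τ (XVar.normal n)

def Term.eval {𝔇 : TypeDomain.{u}} {V : 𝔇.Ty → Type} {τ : 𝔇.Ty} (σ : 𝔇.Assignment V) :
    Term 𝔇 V τ → 𝔇.Dom τ
  | .var x => σ τ x
  | .val o => o

/-- Inscriptions of input and read arcs: tuples of normal variables. -/
abbrev InInsc (𝔇 : TypeDomain.{u}) (c : 𝔇.Color) : Type :=
  (i : Fin c.length) → 𝔇.NVar (c.get i)

/-- Inscriptions of output arcs and of action bindings: tuples of normal variables, fresh
variables and values. -/
abbrev OutInsc (𝔇 : TypeDomain.{u}) (c : 𝔇.Color) : Type u :=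
  (i : Fin c.length) → Term 𝔇 𝔇.XVar (c.get i)

def Binding.inTuple {𝔇 : TypeDomain.{u}} (σ : 𝔇.Binding) {c : 𝔇.Color} (w : 𝔇.InInsc c) :
    𝔇.Tuple c :=
  fun i => σ.onNormal _ (w i)

def Binding.outTuple {𝔇 : TypeDomain.{u}} (σ : 𝔇.Binding) {c : 𝔇.Color} (w : 𝔇.OutInsc c) :
    𝔇.Tuple c :=
  fun i => (w i).eval σ

/-- The variables that occur in an output inscription. -/
def outVars (𝔇 : TypeDomain.{u}) {c : 𝔇.Color} (w : 𝔇.OutInsc c) : Set (Σ τ, 𝔇.XVar τ) :=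
  {v | ∃ i, (⟨c.get i, w i⟩ : Σ τ, Term 𝔇 𝔇.XVar τ) = ⟨v.1, Term.var v.2⟩}

/-- The fresh variables among `vars` get pairwise distinct values, none of which is in `used`. -/
def Binding.FreshFor {𝔇 : TypeDomain.{u}} (σ : 𝔇.Binding) (vars : Set (Σ τ, 𝔇.XVar τ))
    (used : (τ : 𝔇.Ty) → Set (𝔇.Dom τ)) : Prop :=
  (∀ τ n h, (⟨τ, XVar.fresh n h⟩ : Σ τ, 𝔇.XVar τ) ∈ vars → σ τ (XVar.fresh n h) ∉ used τ) ∧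
  (∀ τ n n' h h', (⟨τ, XVar.fresh n h⟩ : Σ τ, 𝔇.XVar τ) ∈ vars →
    (⟨τ, XVar.fresh n' h'⟩ : Σ τ, 𝔇.XVar τ) ∈ vars →
    σ τ (XVar.fresh n h) = σ τ (XVar.fresh n' h') → n = n')

/-- Guards: quantifier-free and relation-free formulas over normal variables. -/
inductive Guard (𝔇 : TypeDomain.{u}) : Type u
  | tru : Guard 𝔇
  | pred {τ : 𝔇.Ty} (S : 𝔇.Pred τ) (y : Fin (𝔇.arity S) → Term 𝔇 𝔇.NVar τ) : Guard 𝔇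
  | not (φ : Guard 𝔇) : Guard 𝔇
  | and (φ ψ : Guard 𝔇) : Guard 𝔇

def Guard.Holds {𝔇 : TypeDomain.{u}} (σ : 𝔇.Assignment 𝔇.NVar) : Guard 𝔇 → Prop
  | .tru => True
  | .pred S y => 𝔇.interp S (fun i => (y i).eval σ)
  | .not φ => ¬ φ.Holds σ
  | .and φ ψ => φ.Holds σ ∧ ψ.Holds σ

end TypeDomain

open TypeDomain (Term XVar Guard)

/-! ## Labelled transition systems and weak bisimulation -/

/-- A labelled transition system over the labels `L`; the label `none` is the silent label. -/
structure LTS (L : Type) where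
  State : Type u
  init : State
  step : State → Option L → State → Prop

namespace LTS

variable {L : Type}

/-- Finitely many silent steps. -/
def Silent (A : LTS.{u} L) : A.State → A.State → Prop :=
  Relation.ReflTransGen (fun p q => A.step p none q)

/-- Weak transitions. -/
def Weak (A : LTS.{u} L) (p : A.State) : Option L → A.State → Prop
  | none, q => A.Silent p q
  | some a, q => ∃ q₁ q₂, A.Silent p q₁ ∧ A.step q₁ (some a) q₂ ∧ A.Silent q₂ q

/-- Weak bisimulations. -/
def IsWeakBisimulation (A B : LTS.{u} L) (wb : A.State → B.State → Prop) : Prop :=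
  ∀ p q, wb p q → ∀ a : Option L,
    (∀ p', A.step p a p' → ∃ q', B.Weak q a q' ∧ wb p' q') ∧
    (∀ q', B.step q a q' → ∃ p', A.Weak p a p' ∧ wb p' q')

/-- The initial states are related by a weak bisimulation all of whose pairs of states are
comparable in the sense of `Comp`. -/
def WeaklyBisimilarWith (A B : LTS.{u} L) (Comp : A.State → B.State → Prop) : Prop :=
  ∃ wb : A.State → B.State → Prop, IsWeakBisimulation A B wb ∧
    (∀ p q, wb p q → Comp p q) ∧ wb A.init B.init

end LTS

/-! ## ν-CPNs, with read arcs and with priorities -/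

/-- A ν-CPN with places `P`, colored by `color`, and transitions `T`. -/
structure NuCPN (𝔇 : TypeDomain.{u}) {P : Type} (color : P → 𝔇.Color) (T : Type) where
  finite_places : Finite P
  finite_trans : Finite T
  inFlow : (p : P) → T → Multiset (𝔇.InInsc (color p))
  readFlow : (p : P) → T → Multiset (𝔇.InInsc (color p))
  guard : T → Guard 𝔇
  outFlow : T → (p : P) → Multiset (𝔇.OutInsc (color p))

/-- Markings: a finite multiset of correctly typed tokens on each place. -/
abbrev Marking (𝔇 : TypeDomain.{u}) {P : Type} (color : P → 𝔇.Color) : Type u :=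
  (p : P) → Multiset (𝔇.Tuple (color p))

/-- The values of type `τ` that occur in a marking. -/
def Marking.adom {𝔇 : TypeDomain.{u}} {P : Type} {color : P → 𝔇.Color} (M : Marking 𝔇 color)
    (τ : 𝔇.Ty) : Set (𝔇.Dom τ) :=
  {o | ∃ p, ∃ a ∈ M p, 𝔇.Occurs a τ o}

namespace NuCPN

variable {𝔇 : TypeDomain.{u}} {P : Type} {color : P → 𝔇.Color} {T : Type}

/-- Input arcs find enough tokens, each read-arc inscription finds a token (a read token is only
inspected, so it may match several read inscriptions), and the guard holds. -/
def Ready (N : NuCPN 𝔇 color T) (M : Marking 𝔇 color) (t : T) (σ : 𝔇.Binding) : Prop :=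
  (∀ p, (N.inFlow p t).map σ.inTuple ≤ M p) ∧
  (∀ p, ∀ w ∈ N.readFlow p t, σ.inTuple w ∈ M p) ∧
  (N.guard t).Holds σ.onNormal

/-- `M'` is `M` minus the consumed tokens plus the tokens produced by the output flow `F`. -/
def Moves (N : NuCPN 𝔇 color T) (F : T → (p : P) → Multiset (𝔇.OutInsc (color p)))
    (M : Marking 𝔇 color) (t : T) (σ : 𝔇.Binding) (M' : Marking 𝔇 color) : Prop :=
  ∀ p, M' p + (N.inFlow p t).map σ.inTuple = M p + (F t p).map σ.outTuple

/-- The variables that occur in an output flow of a transition. -/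
def flowVars (F : T → (p : P) → Multiset (𝔇.OutInsc (color p))) (t : T) :
    Set (Σ τ, 𝔇.XVar τ) :=
  {v | ∃ p, ∃ w ∈ F t p, v ∈ 𝔇.outVars w}

/-- Enabledness, priorities left aside. -/
def Enabled (N : NuCPN 𝔇 color T) (M : Marking 𝔇 color) (t : T) (σ : 𝔇.Binding) : Prop :=
  N.Ready M t σ ∧ σ.FreshFor (flowVars N.outFlow t) M.adom

end NuCPN

/-- A ν-CPN with transition priorities (a larger number is a higher priority). -/
structure PrioNuCPN (𝔇 : TypeDomain.{u}) {P : Type} (color : P → 𝔇.Color) (T : Type)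
    extends NuCPN 𝔇 color T where
  prio : T → ℕ

namespace PrioNuCPN

variable {𝔇 : TypeDomain.{u}} {P : Type} {color : P → 𝔇.Color} {T : Type}

/-- A transition fires if it is enabled and no transition of higher priority is enabled. -/
def Fires (N : PrioNuCPN 𝔇 color T) (M : Marking 𝔇 color) (t : T) (σ : 𝔇.Binding)
    (M' : Marking 𝔇 color) : Prop :=
  N.Enabled M t σ ∧ (∀ t' σ', N.Enabled M t' σ' → N.prio t' ≤ N.prio t) ∧
  N.Moves N.outFlow M t σ M'

/-- The transition system of a marked net whose transitions are labelled by `label`. -/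
def lts (N : PrioNuCPN 𝔇 color T) {L : Type} (label : T → Option L) (M₀ : Marking 𝔇 color) :
    LTS.{u} L where
  State := Marking 𝔇 color
  init := M₀
  step M a M' := ∃ t σ, label t = a ∧ N.Fires M t σ M'

end PrioNuCPN

/-! ## Persistence layer -/

/-- A database schema: finitely many typed relation schemas. -/
structure Schema (𝔇 : TypeDomain.{u}) where
  Rel : Type
  finite_rel : Finite Rel
  sig : Rel → 𝔇.Color

/-- A fact `R(o₁, …, oₙ)`. -/
abbrev Schema.Fact {𝔇 : TypeDomain.{u}} (S : Schema 𝔇) : Type u := Σ R : S.Rel, 𝔇.Tuple (S.sig R)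

/-- A database instance: a finite set of facts. -/
abbrev Schema.Instance {𝔇 : TypeDomain.{u}} (S : Schema 𝔇) : Type u := Finset S.Fact

/-- The active domain of an instance, for the type `τ`. -/
def Schema.adom {𝔇 : TypeDomain.{u}} (S : Schema 𝔇) (I : S.Instance) (τ : 𝔇.Ty) :
    Set (𝔇.Dom τ) :=
  {o | ∃ f ∈ I, 𝔇.Occurs f.2 τ o}

/-- Well-typed first-order formulas over a schema and the predicates of the data types. -/
inductive FO {𝔇 : TypeDomain.{u}} (S : Schema 𝔇) : Type u
  | tru : FO S
  | fls : FO S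
  | rel (R : S.Rel) (z : (i : Fin (S.sig R).length) → Term 𝔇 𝔇.NVar ((S.sig R).get i)) : FO S
  | pred {τ : 𝔇.Ty} (Q : 𝔇.Pred τ) (y : Fin (𝔇.arity Q) → Term 𝔇 𝔇.NVar τ) : FO S
  | not (φ : FO S) : FO S
  | and (φ ψ : FO S) : FO S
  | or (φ ψ : FO S) : FO S
  | ex (τ : 𝔇.Ty) (x : 𝔇.NVar τ) (φ : FO S) : FO S
  | all (τ : 𝔇.Ty) (x : 𝔇.NVar τ) (φ : FO S) : FO S

namespace FO

variable {𝔇 : TypeDomain.{u}} {S : Schema 𝔇}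

/-- Free variables. -/
def free : FO S → Set (Σ τ, 𝔇.NVar τ)
  | tru => ∅
  | fls => ∅
  | rel R z => {v | ∃ i, (⟨(S.sig R).get i, z i⟩ : Σ τ, Term 𝔇 𝔇.NVar τ) = ⟨v.1, Term.var v.2⟩}
  | pred (τ := τ) _ y => {v | ∃ i, (⟨τ, y i⟩ : Σ τ, Term 𝔇 𝔇.NVar τ) = ⟨v.1, Term.var v.2⟩}
  | not φ => φ.free
  | and φ ψ => φ.free ∪ ψ.free
  | or φ ψ => φ.free ∪ ψ.free
  | ex τ x φ => φ.free \ {⟨τ, x⟩}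
  | all τ x φ => φ.free \ {⟨τ, x⟩}

open scoped Classical in
/-- Satisfaction under the active-domain semantics. -/
def Sat (I : S.Instance) : FO S → 𝔇.Assignment 𝔇.NVar → Prop
  | tru, _ => True
  | fls, _ => False
  | rel R z, θ => (⟨R, fun i => (z i).eval θ⟩ : S.Fact) ∈ I
  | pred Q y, θ => 𝔇.interp Q (fun i => (y i).eval θ)
  | not φ, θ => ¬ φ.Sat I θ
  | and φ ψ, θ => φ.Sat I θ ∧ ψ.Sat I θ
  | or φ ψ, θ => φ.Sat I θ ∨ ψ.Sat I θ
  | ex τ x φ, θ => ∃ o ∈ S.adom I τ, φ.Sat I (Function.update θ τ (Function.update (θ τ) x o))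
  | all τ x φ, θ => ∀ o ∈ S.adom I τ, φ.Sat I (Function.update θ τ (Function.update (θ τ) x o))

/-- Conjunctions of relation atoms, predicate atoms and negated predicate atoms. -/
inductive IsConj : FO S → Prop
  | tru : IsConj tru
  | rel (R z) : IsConj (rel R z)
  | pred {τ : 𝔇.Ty} (Q : 𝔇.Pred τ) (y) : IsConj (pred Q y)
  | npred {τ : 𝔇.Ty} (Q : 𝔇.Pred τ) (y) : IsConj (not (pred Q y))
  | and {φ ψ} : IsConj φ → IsConj ψ → IsConj (and φ ψ)

/-- Existentially quantified such conjunctions. -/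
inductive IsCQF : FO S → Prop
  | conj {φ} : IsConj φ → IsCQF φ
  | ex (τ x) {φ} : IsCQF φ → IsCQF (ex τ x φ)

/-- Finite disjunctions of existentially quantified such conjunctions. -/
inductive IsUCQF : FO S → Prop
  | fls : IsUCQF fls
  | cqf {φ} : IsCQF φ → IsUCQF φ
  | or {φ ψ} : IsUCQF φ → IsUCQF ψ → IsUCQF (or φ ψ)

end FO

/-- A query: answer variables together with a formula whose free variables are among them. -/
structure Query {𝔇 : TypeDomain.{u}} (S : Schema 𝔇) where
  types : 𝔇.Color
  head : 𝔇.InInsc types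
  body : FO S
  free_sub : ∀ v ∈ body.free, ∃ i, (⟨types.get i, head i⟩ : Σ τ, 𝔇.NVar τ) = v

/-- The answers, as tuples of values for the answer variables; answer variables range over the
active domain. -/
def Query.ans {𝔇 : TypeDomain.{u}} {S : Schema 𝔇} (Q : Query S) (I : S.Instance) :
    Set (𝔇.Tuple Q.types) :=
  {a | ∃ θ : 𝔇.Assignment 𝔇.NVar,
    (∀ i, θ _ (Q.head i) = a i ∧ a i ∈ S.adom I (Q.types.get i)) ∧ Q.body.Sat I θ}

/-- A persistence layer: a schema and a finite set of boolean queries, the constraints. -/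
structure PersistenceLayer (𝔇 : TypeDomain.{u}) where
  schema : Schema 𝔇
  constraints : Set (Query schema)
  finite_constraints : constraints.Finite
  boolean_constraints : ∀ Φ ∈ constraints, Φ.types = []

/-- The instance satisfies all constraints. -/
def PersistenceLayer.Complies {𝔇 : TypeDomain.{u}} (P : PersistenceLayer 𝔇)
    (I : P.schema.Instance) : Prop :=
  ∀ Φ ∈ P.constraints, (Φ.ans I).Nonempty

/-! ## Data logic layer -/

/-- A fact template over formal parameters of the types `params`; a parameter is given by its
position. -/
structure FactTemplate {𝔇 : TypeDomain.{u}} (S : Schema 𝔇) (params : 𝔇.Color) where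
  rel : S.Rel
  args : (i : Fin (S.sig rel).length) →
    Term 𝔇 (fun τ => {k : Fin params.length // params.get k = τ}) ((S.sig rel).get i)

/-- The fact obtained from a template by substituting values for the parameters. -/
def FactTemplate.ground {𝔇 : TypeDomain.{u}} {S : Schema 𝔇} {params : 𝔇.Color}
    (f : FactTemplate S params) (a : 𝔇.Tuple params) : S.Fact :=
  ⟨f.rel, fun i => (f.args i).eval (V := fun τ => {k : Fin params.length // params.get k = τ})
    (fun _ k => k.2 ▸ a k.1)⟩

/-- A parameterized action: parameters, facts to be added, facts to be deleted. -/
structure DBAction {𝔇 : TypeDomain.{u}} (S : Schema 𝔇) where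
  params : 𝔇.Color
  add : Finset (FactTemplate S params)
  del : Finset (FactTemplate S params)

open scoped Classical in
/-- Application of an action instance: first deletions, then additions. -/
noncomputable def DBAction.apply {𝔇 : TypeDomain.{u}} {S : Schema 𝔇} (α : DBAction S)
    (a : 𝔇.Tuple α.params) (I : S.Instance) : S.Instance :=
  (I \ α.del.image (fun f => f.ground a)) ∪ α.add.image (fun f => f.ground a)

/-- A data logic layer: finitely many queries and finitely many (named) actions. -/
structure DataLogicLayer {𝔇 : TypeDomain.{u}} (S : Schema 𝔇) where
  Qry : Type
  finite_qry : Finite Qry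
  query : Qry → Query S
  Act : Type
  finite_act : Finite Act
  action : Act → DBAction S

/-! ## Control layer and DB-nets -/

/-- A control layer. The color of a view place is given by the types of the answer variables of
its query. -/
structure ControlLayer {𝔇 : TypeDomain.{u}} {S : Schema 𝔇} (𝓛 : DataLogicLayer S) where
  CtrlPlace : Type
  ViewPlace : Type
  finite_view : Finite ViewPlace
  Trans : Type
  color : CtrlPlace → 𝔇.Color
  net : NuCPN 𝔇 color Trans
  query : ViewPlace → 𝓛.Qry
  viewRead : (v : ViewPlace) → Trans → Multiset (𝔇.InInsc (𝓛.query (query v)).types)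
  act : Trans → Option (Σ α : 𝓛.Act, 𝔇.OutInsc (𝓛.action α).params)
  rollbackFlow : Trans → (p : CtrlPlace) → Multiset (𝔇.OutInsc (color p))

structure DBNet where
  domain : TypeDomain.{u}
  persistence : PersistenceLayer domain
  logic : DataLogicLayer persistence.schema
  control : ControlLayer logic

namespace DBNet

/-- A snapshot: a compliant database instance and a marking of the control places. (The content
of a view place is not stored: it is always the set of answers to its query.) -/
structure Snapshot (B : DBNet.{u}) where
  inst : B.persistence.schema.Instance
  complies : B.persistence.Complies inst
  mark : Marking B.domain B.control.color

/-- The variables that occur in the normal output flow, in the rollback flow or in the action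
inscription of a transition. -/
def outVars (B : DBNet.{u}) (t : B.control.Trans) : Set (Σ τ, B.domain.XVar τ) :=
  NuCPN.flowVars B.control.net.outFlow t ∪ NuCPN.flowVars B.control.rollbackFlow t ∪
    {v | ∃ x ∈ B.control.act t, v ∈ B.domain.outVars x.2}

/-- Enabledness of a transition with a binding in a snapshot. -/
def Enabled (B : DBNet.{u}) (s : B.Snapshot) (t : B.control.Trans) (σ : B.domain.Binding) : Prop :=
  B.control.net.Ready s.mark t σ ∧
  (∀ v, ∀ w ∈ B.control.viewRead v t,
    σ.inTuple w ∈ (B.logic.query (B.control.query v)).ans s.inst) ∧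
  σ.FreshFor (B.outVars t) (fun τ => B.persistence.schema.adom s.inst τ ∪ s.mark.adom τ)

/-- The instance obtained by the action (if any) of a transition, before constraints are
checked. -/
noncomputable def updated (B : DBNet.{u}) (I : B.persistence.schema.Instance)
    (t : B.control.Trans) (σ : B.domain.Binding) : B.persistence.schema.Instance :=
  match B.control.act t with
  | none => I
  | some x => (B.logic.action x.1).apply (σ.outTuple x.2) I

/-- Firing: the update is committed if it complies with the constraints, otherwise it is rolled
back and the rollback flow is used. -/
def Fires (B : DBNet.{u}) (s : B.Snapshot) (t : B.control.Trans) (σ : B.domain.Binding)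
    (s' : B.Snapshot) : Prop :=
  B.Enabled s t σ ∧
  ((B.persistence.Complies (B.updated s.inst t σ) ∧ s'.inst = B.updated s.inst t σ ∧
      B.control.net.Moves B.control.net.outFlow s.mark t σ s'.mark) ∨
   (¬ B.persistence.Complies (B.updated s.inst t σ) ∧ s'.inst = s.inst ∧
      B.control.net.Moves B.control.rollbackFlow s.mark t σ s'.mark))

/-- The transition system of a DB-net; its labels are the transitions of the net, and no step is
silent. -/
def lts (B : DBNet.{u}) (s₀ : B.Snapshot) : LTS.{u} B.control.Trans where
  State := B.Snapshot
  init := s₀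
  step s a s' := ∃ t σ, a = some t ∧ B.Fires s t σ s'

/-- Places of a translated net: the control places, one relation place for each relation, and
auxiliary places. -/
abbrev EncPlace (B : DBNet.{u}) (PAux : Type) : Type :=
  B.control.CtrlPlace ⊕ (B.persistence.schema.Rel ⊕ PAux)

/-- Control places keep their color, and relation places have the signature of the relation. -/
abbrev encColor (B : DBNet.{u}) {PAux : Type} (auxColor : PAux → B.domain.Color) :
    B.EncPlace PAux → B.domain.Color :=
  Sum.elim B.control.color (Sum.elim B.persistence.schema.sig auxColor)

/-- A snapshot and a marking of a translated net have the same content: they agree on the control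
places, and each relation place holds exactly the facts of its relation, each one once. Auxiliary
places are ignored. -/
def FlatEq (B : DBNet.{u}) {PAux : Type} {auxColor : PAux → B.domain.Color} (s : B.Snapshot)
    (M : Marking B.domain (B.encColor auxColor)) : Prop :=
  (∀ p, M (Sum.inl p) = s.mark p) ∧
  (∀ R, (M (Sum.inr (Sum.inl R))).Nodup ∧
    ∀ a : B.domain.Tuple (B.persistence.schema.sig R),
      a ∈ M (Sum.inr (Sum.inl R)) ↔ (⟨R, a⟩ : B.persistence.schema.Fact) ∈ s.inst)

end DBNet

/-!
Silent steps must leave control and relation places unchanged, so a copy of a transition `t` of the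
DB-net has to perform the whole update of `t` in one step. The net cannot test for the absence of a
fact within that step, and relation places hold each fact at most once. The encoding therefore
guesses and verifies. It carries a single auxiliary token. In the idle state this token has no
components. A silent transition replaces it by a token that stores the values of the output
variables of `t` and the components of all facts that the action of `t` adds or deletes, together
with a *choice* (`Unfolding.Choice`), which is recorded in the place of the token: which of these
facts are equal, which are present in the database, and by which disjuncts the view queries are
satisfied. Since the idle token contains no values, the native freshness condition of the guessing
transition is exactly that of the DB-net.

A wrong choice can be refuted positively: two facts declared different match the same variables, or
a fact declared absent is read from its relation place. The silent transitions that detect this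
have the higher priority and withdraw the guess (`refuted_of_enabled`, `Refuted.exists_enabled`),
so the visible transition fires only for guesses that are not refuted. It consumes the facts
declared present and produces those present after the update, one copy for each class of equal
facts; `Unfolding.Choice.nodup_and_mem_updated` shows that this is the update. As any other guess
can be withdrawn too, the encoding can always return to the idle state
(`Encodes.exists_silent_idle`), so no guess commits it.

View places are read directly from the relation places. A query in `UCQF` is a finite disjunction
of *readers* (`Reader.Realizable`), which consist of read arcs, a guard, and *pins*. Pins account
for constants and repeated answer variables, since arcs carry variables only and there need not be
an equality predicate: the guessed token holds the value in question, and the visible transition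
matches it with the variables that have to be equal to it.

The weak bisimulation is `Encodes`: the snapshot and the marking agree, and the encoding is idle or
holds a guess whose fresh values are fresh.
-/

open TypeDomain

/-! ### Variables -/

namespace TypeDomain

variable {𝔇 : TypeDomain.{u}}

/-- Variables that are distinguished by their type and number can be given arbitrary values. -/
theorem exists_assignment_extending {ι : Type*} (typ : ι → 𝔇.Ty) (num : ι → ℕ)
    (hinj : ∀ s s', typ s = typ s' → num s = num s' → s = s') (val : ∀ s, 𝔇.Dom (typ s))
    (σ : 𝔇.Assignment 𝔇.NVar) :
    ∃ σ' : 𝔇.Assignment 𝔇.NVar, (∀ τ n, (∀ s, num s ≠ n) → σ' τ n = σ τ n) ∧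
      ∀ s, σ' (typ s) (num s) = val s := by
  classical
  refine ⟨fun τ n => if h : ∃ s, typ s = τ ∧ num s = n then h.choose_spec.1 ▸ val h.choose
    else σ τ n, ?_, ?_⟩
  · intro τ n hn
    refine dif_neg ?_
    rintro ⟨s, -, h⟩
    exact hn s h
  · intro s
    have h : ∃ s', typ s' = typ s ∧ num s' = num s := ⟨s, rfl, rfl⟩
    refine (dif_pos h).trans ?_
    have key : ∀ s' (e : typ s' = typ s), s' = s → e ▸ val s' = val s := by
      rintro _ e rfl
      rfl
    exact key _ _ (hinj _ _ h.choose_spec.1 h.choose_spec.2)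

/-- The number under which the variables of a DB-net occur, as normal variables, in its encoding.
The residues 2 and 3 modulo 4 are left for query witnesses and for components of facts. -/
def XVar.code {τ : 𝔇.Ty} : XVar 𝔇 τ → ℕ
  | .normal n => 4 * n
  | .fresh n _ => 4 * n + 1

theorem XVar.code_injective {τ : 𝔇.Ty} : Function.Injective (XVar.code (𝔇 := 𝔇) (τ := τ)) := by
  rintro (n | ⟨n, h⟩) (n' | ⟨n', h'⟩) e <;> simp only [XVar.code] at e
  · rw [show n = n' by omega]
  · omega
  · omega
  · obtain rfl : n = n' := by omega
    rfl

theorem XVar.code_mod {τ : 𝔇.Ty} (v : XVar 𝔇 τ) : v.code % 4 < 2 := by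
  cases v <;> simp only [XVar.code] <;> omega

/-- The binding of the variables of a DB-net given by an assignment to their codes. -/
def decode (σ : 𝔇.Assignment 𝔇.NVar) : 𝔇.Binding := fun τ v => σ τ v.code

/-- The two assignments agree on all variables except the query witnesses of index at least `k`. -/
def AgreeBelow (k : ℕ) (σ σ' : 𝔇.Assignment 𝔇.NVar) : Prop :=
  ∀ τ n, (n % 4 = 2 → n < 4 * k) → σ τ n = σ' τ n

theorem AgreeBelow.refl (k : ℕ) (σ : 𝔇.Assignment 𝔇.NVar) : AgreeBelow k σ σ :=
  fun _ _ _ => rfl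

theorem AgreeBelow.symm {k : ℕ} {σ σ' : 𝔇.Assignment 𝔇.NVar} (h : AgreeBelow k σ σ') :
    AgreeBelow k σ' σ := fun τ n hn => (h τ n hn).symm

theorem AgreeBelow.trans {k : ℕ} {σ σ' σ'' : 𝔇.Assignment 𝔇.NVar} (h : AgreeBelow k σ σ')
    (h' : AgreeBelow k σ' σ'') : AgreeBelow k σ σ'' :=
  fun τ n hn => (h τ n hn).trans (h' τ n hn)

theorem AgreeBelow.mono {k k' : ℕ} (hk : k ≤ k') {σ σ' : 𝔇.Assignment 𝔇.NVar}
    (h : AgreeBelow k' σ σ') : AgreeBelow k σ σ' :=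
  fun τ n hn => h τ n fun h2 => by have := hn h2; omega

/-- The witnesses of index `k, k + 1, …` can be given the components of any tuple. -/
theorem exists_agreeBelow_tuple (k : ℕ) {c : 𝔇.Color} (a : 𝔇.Tuple c)
    (σ : 𝔇.Assignment 𝔇.NVar) :
    ∃ σ', AgreeBelow k σ σ' ∧ ∀ i, σ' (c.get i) (4 * (k + i.1) + 2) = a i := by
  obtain ⟨σ', h1, h2⟩ := exists_assignment_extending (fun i => c.get i)
    (fun i : Fin c.length => 4 * (k + i.1) + 2)
    (fun s s' _ h => by ext; omega) a σ
  refine ⟨σ', fun τ n hn => (h1 τ n fun s hs => ?_).symm, h2⟩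
  have := hn (by omega)
  omega

/-- Renaming of the variables of a term. -/
def Term.rename {V W : 𝔇.Ty → Type} {τ : 𝔇.Ty} (ρ : ∀ τ, V τ → W τ) :
    Term 𝔇 V τ → Term 𝔇 W τ
  | .var x => .var (ρ τ x)
  | .val o => .val o

theorem Term.eval_rename {V W : 𝔇.Ty → Type} {τ : 𝔇.Ty} (ρ : ∀ τ, V τ → W τ)
    (σ : 𝔇.Assignment W) (z : Term 𝔇 V τ) :
    (z.rename ρ).eval σ = z.eval fun τ x => σ τ (ρ τ x) := by
  cases z <;> rfl

/-- Renaming of the variables of a guard. -/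
def Guard.rename (ρ : ∀ τ, 𝔇.NVar τ → 𝔇.NVar τ) : Guard 𝔇 → Guard 𝔇
  | .tru => .tru
  | .pred S y => .pred S fun i => (y i).rename ρ
  | .not φ => .not (φ.rename ρ)
  | .and φ ψ => .and (φ.rename ρ) (ψ.rename ρ)

theorem Guard.holds_rename (ρ : ∀ τ, 𝔇.NVar τ → 𝔇.NVar τ) (σ : 𝔇.Assignment 𝔇.NVar)
    (g : Guard 𝔇) : (g.rename ρ).Holds σ ↔ g.Holds fun τ n => σ τ (ρ τ n) := by
  induction g with
  | tru => rfl
  | pred S y => simp only [Guard.rename, Guard.Holds, Term.eval_rename]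
  | not φ ih => simp only [Guard.rename, Guard.Holds, ih]
  | and φ ψ ih ih' => simp only [Guard.rename, Guard.Holds, ih, ih']

end TypeDomain

/-! ### Queries as read arcs -/

/-- A conjunctive test on a database instance that one transition can perform. A read `(R, w)`
looks for a fact of `R` whose `i`-th component is the value of the variable `w i`. A pin `(x, z)`
demands that the variable `x` has the value of the term `z`, in which variables are named as in
the DB-net. -/
structure Reader {𝔇 : TypeDomain.{u}} (S : Schema 𝔇) where
  reads : List (S.Rel × (ℕ → ℕ))
  guard : Guard 𝔇
  pins : List (Σ τ, ℕ × Term 𝔇 𝔇.NVar τ)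

namespace Reader

variable {𝔇 : TypeDomain.{u}} {S : Schema 𝔇}

/-- The test succeeds on the instance `I` under the assignment `σ`. -/
def Holds (r : Reader S) (I : S.Instance) (σ : 𝔇.Assignment 𝔇.NVar) : Prop :=
  (∀ x ∈ r.reads, (⟨x.1, fun i => σ _ (x.2 i.1)⟩ : S.Fact) ∈ I) ∧ r.guard.Holds σ ∧
    ∀ y ∈ r.pins, σ y.1 y.2.1 = y.2.2.eval (decode σ).onNormal

/-- The test that performs both tests. -/
def and (r r' : Reader S) : Reader S where
  reads := r.reads ++ r'.reads
  guard := r.guard.and r'.guard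
  pins := r.pins ++ r'.pins

theorem holds_and (r r' : Reader S) (I : S.Instance) (σ : 𝔇.Assignment 𝔇.NVar) :
    (r.and r').Holds I σ ↔ r.Holds I σ ∧ r'.Holds I σ := by
  simp only [Holds, Reader.and, List.mem_append, or_imp, forall_and, Guard.Holds]
  tauto

/-- The reader does not inspect query witnesses of index at least `k`. -/
def Below (r : Reader S) (k : ℕ) : Prop :=
  ∀ I σ σ', AgreeBelow k σ σ' → r.Holds I σ → r.Holds I σ'

theorem Below.mono {r : Reader S} {k k' : ℕ} (h : r.Below k) (hk : k ≤ k') : r.Below k' :=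
  fun I σ σ' hσ => h I σ σ' (hσ.mono hk)

/-- `P` is a disjunction of finitely many readers, up to the choice of the witnesses of index at
least `k`. -/
def RealizableAt (k : ℕ) (P : S.Instance → 𝔇.Assignment 𝔇.NVar → Prop) : Prop :=
  ∃ k' ≥ k, ∃ L : List (Reader S), (∀ r ∈ L, r.Below k') ∧
    ∀ I σ, P I σ ↔ ∃ σ', AgreeBelow k σ σ' ∧ ∃ r ∈ L, r.Holds I σ'

/-- `P` is a disjunction of finitely many readers, and the readers can avoid any finite set of
witnesses. -/
def Realizable (k : ℕ) (P : S.Instance → 𝔇.Assignment 𝔇.NVar → Prop) : Prop :=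
  ∀ k' ≥ k, RealizableAt k' P

theorem RealizableAt.congr {k : ℕ} {P : S.Instance → 𝔇.Assignment 𝔇.NVar → Prop}
    (h : RealizableAt k P) {I σ σ'} (hσ : AgreeBelow k σ σ') (hP : P I σ) : P I σ' := by
  obtain ⟨_, _, L, _, h⟩ := h
  obtain ⟨σ₁, h1, h2⟩ := (h _ _).1 hP
  exact (h _ _).2 ⟨σ₁, hσ.symm.trans h1, h2⟩

theorem Realizable.and {k : ℕ} {P Q : S.Instance → 𝔇.Assignment 𝔇.NVar → Prop}
    (hP : Realizable k P) (hQ : Realizable k Q) : Realizable k fun I σ => P I σ ∧ Q I σ := by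
  intro k₀ hk₀
  have hQ₀ := hQ k₀ hk₀
  obtain ⟨k₁, hk₁, L₁, hb₁, h₁⟩ := hP k₀ hk₀
  -- The readers for `Q` avoid the witnesses used for `P`.
  obtain ⟨k₂, hk₂, L₂, hb₂, h₂⟩ := hQ k₁ (by omega)
  refine ⟨k₂, by omega, L₁.flatMap fun r => L₂.map r.and, ?_, fun I σ => ⟨?_, ?_⟩⟩
  · simp only [List.mem_flatMap, List.mem_map]
    rintro _ ⟨r, hr, r', hr', rfl⟩ I σ σ' hσ h
    rw [holds_and] at h ⊢
    exact ⟨hb₁ r hr _ _ _ (hσ.mono hk₂) h.1, hb₂ r' hr' _ _ _ hσ h.2⟩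
  · rintro ⟨hPσ, hQσ⟩
    obtain ⟨σ₁, hσ₁, r, hr, hrσ⟩ := (h₁ _ _).1 hPσ
    obtain ⟨σ₂, hσ₂, r', hr', hrσ'⟩ := (h₂ _ _).1 (hQ₀.congr hσ₁ hQσ)
    refine ⟨σ₂, hσ₁.trans (hσ₂.mono hk₁), r.and r', ?_, ?_⟩
    · simp only [List.mem_flatMap, List.mem_map]
      exact ⟨r, hr, r', hr', rfl⟩
    · exact (holds_and _ _ _ _).2 ⟨hb₁ r hr _ _ _ hσ₂ hrσ, hrσ'⟩
  · simp only [List.mem_flatMap, List.mem_map]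
    rintro ⟨σ', hσ', _, ⟨r, hr, r', hr', rfl⟩, h⟩
    rw [holds_and] at h
    exact ⟨(h₁ _ _).2 ⟨σ', hσ', r, hr, h.1⟩,
      hQ₀.congr hσ'.symm ((h₂ _ _).2 ⟨σ', .refl _ _, r', hr', h.2⟩)⟩

theorem Realizable.or {k : ℕ} {P Q : S.Instance → 𝔇.Assignment 𝔇.NVar → Prop}
    (hP : Realizable k P) (hQ : Realizable k Q) : Realizable k fun I σ => P I σ ∨ Q I σ := by
  intro k₀ hk₀
  obtain ⟨k₁, hk₁, L₁, hb₁, h₁⟩ := hP k₀ hk₀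
  obtain ⟨k₂, hk₂, L₂, hb₂, h₂⟩ := hQ k₀ hk₀
  refine ⟨max k₁ k₂, by omega, L₁ ++ L₂, ?_, fun I σ => ?_⟩
  · intro r hr
    rcases List.mem_append.1 hr with hr | hr
    · exact (hb₁ r hr).mono (le_max_left _ _)
    · exact (hb₂ r hr).mono (le_max_right _ _)
  · simp only [h₁, h₂, List.mem_append, or_and_right, exists_or, and_or_left]

theorem realizable_false (k : ℕ) :
    Realizable k fun (_ : S.Instance) (_ : 𝔇.Assignment 𝔇.NVar) => False :=
  fun k' _ => ⟨k', le_rfl, [], by simp, by simp⟩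

theorem realizable_true (k : ℕ) :
    Realizable k fun (_ : S.Instance) (_ : 𝔇.Assignment 𝔇.NVar) => True :=
  fun k' _ => ⟨k', le_rfl, [⟨[], .tru, []⟩],
    by simp [Below, Holds, Guard.Holds], fun I σ => by
      simpa [Holds, Guard.Holds] using ⟨σ, AgreeBelow.refl _ _⟩⟩

theorem Realizable.forall_mem {ι : Type*} {k : ℕ}
    {P : ι → S.Instance → 𝔇.Assignment 𝔇.NVar → Prop}
    (l : List ι) (h : ∀ i ∈ l, Realizable k (P i)) : Realizable k fun I σ => ∀ i ∈ l, P i I σ := by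
  induction l with
  | nil => simpa using realizable_true k
  | cons a l ih =>
    simp only [List.mem_cons, forall_eq_or_imp]
    simp only [List.mem_cons, forall_eq_or_imp] at h
    exact h.1.and (ih h.2)

theorem Realizable.exists_mem {ι : Type*} {k : ℕ}
    {P : ι → S.Instance → 𝔇.Assignment 𝔇.NVar → Prop}
    (l : List ι) (h : ∀ i ∈ l, Realizable k (P i)) : Realizable k fun I σ => ∃ i ∈ l, P i I σ := by
  induction l with
  | nil => simpa using realizable_false k
  | cons a l ih =>
    simp only [List.mem_cons, exists_eq_or_imp]
    simp only [List.mem_cons, forall_eq_or_imp] at h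
    exact h.1.or (ih h.2)

theorem Realizable.forall_finite {ι : Type*} [Finite ι] {k : ℕ}
    {P : ι → S.Instance → 𝔇.Assignment 𝔇.NVar → Prop} (h : ∀ i, Realizable k (P i)) :
    Realizable k fun I σ => ∀ i, P i I σ := by
  have := Fintype.ofFinite ι
  simpa using Realizable.forall_mem (P := P) Finset.univ.toList fun i _ => h i

theorem Realizable.exists_finite {ι : Type*} [Finite ι] {k : ℕ}
    {P : ι → S.Instance → 𝔇.Assignment 𝔇.NVar → Prop} (h : ∀ i, Realizable k (P i)) :
    Realizable k fun I σ => ∃ i, P i I σ := by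
  have := Fintype.ofFinite ι
  simpa using Realizable.exists_mem (P := P) Finset.univ.toList fun i _ => h i

/-- Witnesses can be quantified existentially. -/
theorem RealizableAt.project {k : ℕ} {P Q : S.Instance → 𝔇.Assignment 𝔇.NVar → Prop}
    {k' : ℕ} (hk : k ≤ k') (hQ : RealizableAt k' Q)
    (h : ∀ I σ, P I σ ↔ ∃ σ', AgreeBelow k σ σ' ∧ Q I σ') : RealizableAt k P := by
  obtain ⟨k₁, hk₁, L, hb, hL⟩ := hQ
  refine ⟨k₁, by omega, L, hb, fun I σ => ?_⟩
  rw [h]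
  constructor
  · rintro ⟨σ₁, h₁, hq⟩
    obtain ⟨σ₂, h₂, hr⟩ := (hL _ _).1 hq
    exact ⟨σ₂, h₁.trans (h₂.mono hk), hr⟩
  · rintro ⟨σ₁, h₁, hr⟩
    exact ⟨σ₁, h₁, (hL _ _).2 ⟨σ₁, .refl _ _, hr⟩⟩

theorem realizableAt_of_reader {k : ℕ} (r : Reader S) (hr : r.Below k) :
    RealizableAt k r.Holds :=
  ⟨k, le_rfl, [r], by simpa using hr, fun I σ => by
    simp only [List.mem_singleton, exists_eq_left]
    exact ⟨fun h => ⟨σ, .refl _ _, h⟩, fun ⟨σ', h, h'⟩ => hr _ _ _ h.symm h'⟩⟩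

/-- Membership in the active domain. The other components of the fact in question are
witnesses. -/
theorem realizable_adom {k : ℕ} {τ : 𝔇.Ty} {x : ℕ} (hx : x % 4 = 2 → x < 4 * k) :
    Realizable k fun (I : S.Instance) σ => σ τ x ∈ S.adom I τ := by
  classical
  have := S.finite_rel
  have key : Realizable k fun (I : S.Instance) σ =>
      ∃ p : {p : Σ R, Fin (S.sig R).length // (S.sig p.1).get p.2 = τ},
        ∃ a : 𝔇.Tuple (S.sig p.1.1), (⟨p.1.1, a⟩ : S.Fact) ∈ I ∧
          (⟨(S.sig p.1.1).get p.1.2, a p.1.2⟩ : Σ τ, 𝔇.Dom τ) = ⟨τ, σ τ x⟩ := by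
    refine Realizable.exists_finite ?_
    rintro ⟨⟨R, i⟩, rfl⟩ k' hk'
    refine RealizableAt.project (k' := k' + (S.sig R).length) (by omega) (realizableAt_of_reader
      ⟨[(R, fun j => if j = i.1 then x else 4 * (k' + j) + 2)], .tru, []⟩ ?_) fun I σ => ?_
    · intro I σ σ' hσ
      simp only [Holds, List.mem_singleton, forall_eq, Guard.Holds]
      intro h
      refine ⟨?_, by simp⟩
      convert h.1 using 3 with j
      refine (hσ _ _ ?_).symm
      split_ifs
      · intro h2; have := hx h2; omega
      · intro; have := j.2; omega
    · simp only [Holds, List.mem_singleton, forall_eq, Guard.Holds]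
      constructor
      · rintro ⟨a, ha, hax⟩
        obtain ⟨σ', h1, h2⟩ := exists_agreeBelow_tuple k' a σ
        refine ⟨σ', h1, ?_, by simp⟩
        convert ha using 3 with j
        split_ifs with hj
        · obtain rfl : j = i := Fin.ext hj
          rw [← h1 _ _ (fun h2 => by have := hx h2; omega)]
          simpa using hax.symm
        · exact h2 j
      · rintro ⟨σ', h1, h2, -⟩
        refine ⟨_, h2, ?_⟩
        simp only [if_true]
        rw [← h1 _ _ (fun h2 => by have := hx h2; omega)]
  convert key using 4 with I σ
  simp only [Schema.adom, Set.mem_ofPred_eq, Occurs]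
  constructor
  · rintro ⟨⟨R, a⟩, hf, i, hi⟩
    exact ⟨⟨⟨R, i⟩, congrArg Sigma.fst hi⟩, a, hf, hi⟩
  · rintro ⟨p, a, ha, hi⟩
    exact ⟨⟨_, a⟩, ha, _, hi⟩

/-- Relation atoms. Constants become witnesses that are pinned to their values, because arc
inscriptions consist of variables. -/
theorem realizable_rel {k : ℕ} {ρ : 𝔇.Ty → ℕ → ℕ}
    (hρ : ∀ τ n, ρ τ n % 4 = 2 → ρ τ n < 4 * k) (R : S.Rel)
    (z : (i : Fin (S.sig R).length) → Term 𝔇 𝔇.NVar ((S.sig R).get i)) :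
    Realizable k fun (I : S.Instance) σ => (FO.rel R z).Sat I fun τ n => σ τ (ρ τ n) := by
  classical
  intro k' hk'
  set w : ∀ i, ℕ := fun i => if h : i < (S.sig R).length then
    match z ⟨i, h⟩ with
    | .var x => ρ ((S.sig R).get ⟨i, h⟩) x
    | .val _ => 4 * (k' + i) + 2 else 0 with hw
  set pins : List (Σ τ, ℕ × Term 𝔇 𝔇.NVar τ) := (List.finRange (S.sig R).length).filterMap
    fun i => match z i with
      | .var _ => none
      | .val o => some ⟨(S.sig R).get i, 4 * (k' + i.1) + 2, .val o⟩ with hpins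
  have hw1 : ∀ i x, z i = .var x → w i.1 = ρ ((S.sig R).get i) x := by
    intro i x h
    simp only [hw, dif_pos i.2]
    rw [show z ⟨i.1, i.2⟩ = .var x from h]
  have hw2 : ∀ i o, z i = .val o → w i.1 = 4 * (k' + i.1) + 2 := by
    intro i o h
    simp only [hw, dif_pos i.2]
    rw [show z ⟨i.1, i.2⟩ = .val o from h]
  have hp : ∀ Q : (Σ τ, ℕ × Term 𝔇 𝔇.NVar τ) → Prop, (∀ y ∈ pins, Q y) ↔
      ∀ i o, z i = .val o → Q ⟨(S.sig R).get i, 4 * (k' + i.1) + 2, .val o⟩ := by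
    intro Q
    simp only [hpins, List.mem_filterMap, List.mem_finRange, true_and]
    constructor
    · intro h i o hz
      exact h _ ⟨i, by rw [hz]⟩
    · rintro h y ⟨i, hi⟩
      cases hz : z i with
      | var x => rw [hz] at hi; simp at hi
      | val o =>
        rw [hz] at hi
        simp only [Option.some.injEq] at hi
        exact hi ▸ h i o hz
  have hlow : ∀ i : Fin (S.sig R).length, w i.1 % 4 = 2 →
      w i.1 < 4 * (k' + (S.sig R).length) := by
    intro i hi
    have := i.2
    cases hz : z i with
    | var x => rw [hw1 i x hz] at hi ⊢; have := hρ _ _ hi; omega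
    | val o => rw [hw2 i o hz] at hi ⊢; omega
  refine RealizableAt.project (k' := k' + (S.sig R).length) (by omega)
    (realizableAt_of_reader ⟨[(R, w)], .tru, pins⟩ ?_) fun I σ => ?_
  · intro I σ σ' hσ
    simp only [Holds, List.mem_singleton, forall_eq, Guard.Holds, hp, Term.eval, true_and]
    rintro ⟨h1, h2⟩
    refine ⟨?_, fun i o hz => ?_⟩
    · convert h1 using 3 with j
      exact (hσ _ _ (hlow j)).symm
    · rw [← h2 i o hz]
      exact (hσ _ _ (by have := i.2; omega)).symm
  · simp only [Holds, List.mem_singleton, forall_eq, Guard.Holds, hp, Term.eval, true_and, FO.Sat]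
    constructor
    · intro h
      obtain ⟨σ', h1, h2⟩ := exists_agreeBelow_tuple k'
        (fun i => (z i).eval fun τ n => σ τ (ρ τ n)) σ
      refine ⟨σ', h1, ?_, fun i o hz => ?_⟩
      · convert h using 3 with i
        cases hz : z i with
        | var x =>
          rw [hw1 i x hz]
          exact (h1 _ _ (fun h => by have := hρ _ _ h; omega)).symm
        | val o => rw [hw2 i o hz, h2 i, hz]; rfl
      · rw [h2 i, hz]; rfl
    · rintro ⟨σ', h1, h2, h3⟩
      convert h2 using 3 with i
      cases hz : z i with
      | var x =>
        rw [hw1 i x hz]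
        exact h1 _ _ (fun h => by have := hρ _ _ h; omega)
      | val o => rw [hw2 i o hz, h3 i o hz]

theorem realizable_guard {k : ℕ} {ρ : 𝔇.Ty → ℕ → ℕ}
    (hρ : ∀ τ n, ρ τ n % 4 = 2 → ρ τ n < 4 * k) (g : Guard 𝔇) :
    Realizable k fun (_ : S.Instance) σ => g.Holds fun τ n => σ τ (ρ τ n) := by
  intro k' hk'
  convert realizableAt_of_reader (S := S) (k := k') ⟨[], g.rename ρ, []⟩ ?_ using 3 with I σ
  · simp [Holds, Guard.holds_rename]
  · intro I σ σ' hσ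
    simp only [Holds, Guard.holds_rename]
    rintro ⟨-, h, -⟩
    refine ⟨by simp, ?_, by simp⟩
    convert h using 3 with τ n
    exact (hσ _ _ fun h => by have := hρ _ _ h; omega).symm

theorem realizable_isConj {φ : FO S} (hφ : φ.IsConj) {k : ℕ} {ρ : 𝔇.Ty → ℕ → ℕ}
    (hρ : ∀ τ n, ρ τ n % 4 = 2 → ρ τ n < 4 * k) :
    Realizable k fun (I : S.Instance) σ => φ.Sat I fun τ n => σ τ (ρ τ n) := by
  induction hφ with
  | tru => exact realizable_true k
  | rel R z => exact realizable_rel hρ R z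
  | pred Q y => exact realizable_guard hρ (.pred Q y)
  | npred Q y => exact realizable_guard hρ (.not (.pred Q y))
  | and _ _ ih ih' => exact ih.and ih'

theorem realizable_isCQF {φ : FO S} (hφ : φ.IsCQF) {k : ℕ} {ρ : 𝔇.Ty → ℕ → ℕ}
    (hρ : ∀ τ n, ρ τ n % 4 = 2 → ρ τ n < 4 * k) :
    Realizable k fun (I : S.Instance) σ => φ.Sat I fun τ n => σ τ (ρ τ n) := by
  classical
  induction hφ generalizing k ρ with
  | conj h => exact realizable_isConj h hρ
  | ex τ x h ih =>
    rename_i φ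
    intro k' hk'
    -- The bound variable becomes the witness of index `k'`.
    set ρ' : 𝔇.Ty → ℕ → ℕ :=
      Function.update ρ τ (Function.update (ρ τ) x (4 * k' + 2)) with hρ'
    have hρ'' : ∀ τ n, ρ' τ n % 4 = 2 → ρ' τ n < 4 * (k' + 1) := by
      intro τ' n h
      by_cases hτ : τ' = τ
      · subst hτ
        simp only [hρ', Function.update_self] at h ⊢
        by_cases hn : n = x
        · subst hn
          simp only [Function.update_self] at h ⊢
          omega
        · rw [Function.update_of_ne hn] at h ⊢
          have := hρ _ _ h
          omega
      · simp only [hρ', Function.update_of_ne hτ] at h ⊢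
        have := hρ _ _ h
        omega
    have hsub : ∀ σ σ' : 𝔇.Assignment 𝔇.NVar, AgreeBelow k' σ σ' →
        (fun τ n => σ' τ (ρ' τ n)) = Function.update (fun τ n => σ τ (ρ τ n)) τ
          (Function.update ((fun τ n => σ τ (ρ τ n)) τ) x (σ' τ (4 * k' + 2))) := by
      intro σ σ' hσ
      funext τ' n
      by_cases hτ : τ' = τ
      · subst hτ
        simp only [hρ', Function.update_self]
        by_cases hn : n = x
        · subst hn
          simp only [Function.update_self]
        · simp only [Function.update_of_ne hn]
          exact (hσ _ _ fun h => by have := hρ _ _ h; omega).symm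
      · simp only [hρ', Function.update_of_ne hτ]
        exact (hσ _ _ fun h => by have := hρ _ _ h; omega).symm
    refine RealizableAt.project (k' := k' + 1) (by omega)
      (((realizable_adom (τ := τ) (x := 4 * k' + 2) (by omega)).and (ih hρ'')) _ le_rfl)
      fun I σ => ?_
    simp only [FO.Sat]
    constructor
    · rintro ⟨o, ho, hs⟩
      obtain ⟨σ', h1, h2⟩ := exists_agreeBelow_tuple k' (c := [τ])
        (fun i => match i with | ⟨0, _⟩ => o) σ
      have h2 : σ' τ (4 * k' + 2) = o := h2 0
      refine ⟨σ', h1, h2 ▸ ho, ?_⟩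
      rw [hsub σ σ' h1, h2]
      convert hs
    · rintro ⟨σ', h1, h2, h3⟩
      refine ⟨_, h2, ?_⟩
      rw [hsub σ σ' h1] at h3
      convert h3

theorem realizable_isUCQF {φ : FO S} (hφ : φ.IsUCQF) {k : ℕ} {ρ : 𝔇.Ty → ℕ → ℕ}
    (hρ : ∀ τ n, ρ τ n % 4 = 2 → ρ τ n < 4 * k) :
    Realizable k fun (I : S.Instance) σ => φ.Sat I fun τ n => σ τ (ρ τ n) := by
  induction hφ with
  | fls => exact realizable_false k
  | cqf h => exact realizable_isCQF h hρ
  | or _ _ ih ih' => exact ih.or ih'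

end Reader

/-- Satisfaction depends only on the values of the free variables. -/
theorem FO.sat_congr {𝔇 : TypeDomain.{u}} {S : Schema 𝔇} {I : S.Instance} {φ : FO S}
    {θ θ' : 𝔇.Assignment 𝔇.NVar} (h : ∀ v ∈ φ.free, θ v.1 v.2 = θ' v.1 v.2) :
    φ.Sat I θ ↔ φ.Sat I θ' := by
  classical
  have hterm : ∀ {θ θ' : 𝔇.Assignment 𝔇.NVar} {τ : 𝔇.Ty} (z : Term 𝔇 𝔇.NVar τ), (∀ x, z = .var x → θ τ x = θ' τ x) →
      z.eval θ = z.eval θ' := by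
    intro θ θ' τ z hz
    cases z with
    | var x => exact hz x rfl
    | val o => rfl
  have hupd : ∀ {θ θ' : 𝔇.Assignment 𝔇.NVar} {φ : FO S} {τ : 𝔇.Ty} {x : 𝔇.NVar τ} (o : 𝔇.Dom τ),
      (∀ v ∈ φ.free \ {⟨τ, x⟩}, θ v.1 v.2 = θ' v.1 v.2) → ∀ v ∈ φ.free,
      Function.update θ τ (Function.update (θ τ) x o) v.1 v.2 =
        Function.update θ' τ (Function.update (θ' τ) x o) v.1 v.2 := by
    rintro θ θ' φ τ x o h ⟨τ', n⟩ hv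
    by_cases hτ : τ' = τ
    · subst hτ
      simp only [Function.update_self]
      by_cases hn : n = x
      · subst hn
        simp only [Function.update_self]
      · simp only [Function.update_of_ne hn]
        exact h _ ⟨hv, fun e => hn (by simpa using e)⟩
    · simp only [Function.update_of_ne hτ]
      exact h _ ⟨hv, fun e => hτ (congrArg Sigma.fst e)⟩
  induction φ generalizing θ θ' with
  | tru => rfl
  | fls => rfl
  | rel R z =>
    simp only [FO.Sat]
    rw [show (fun i => (z i).eval θ) = fun i => (z i).eval θ' from
      funext fun i => hterm _ fun x hx => h ⟨_, x⟩ ⟨i, by rw [hx]⟩]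
  | pred Q y =>
    simp only [FO.Sat]
    rw [show (fun i => (y i).eval θ) = fun i => (y i).eval θ' from
      funext fun i => hterm _ fun x hx => h ⟨_, x⟩ ⟨i, by rw [hx]⟩]
  | not φ ih => exact not_congr (ih h)
  | and φ ψ ih ih' =>
    exact and_congr (ih fun v hv => h v (Or.inl hv)) (ih' fun v hv => h v (Or.inr hv))
  | or φ ψ ih ih' =>
    exact or_congr (ih fun v hv => h v (Or.inl hv)) (ih' fun v hv => h v (Or.inr hv))
  | ex τ x φ ih =>
    simp only [FO.Sat]
    refine exists_congr fun o => and_congr_right fun _ => ih ?_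
    convert hupd o h
  | all τ x φ ih =>
    simp only [FO.Sat]
    refine forall_congr' fun o => forall_congr' fun _ => ih ?_
    convert hupd o h

namespace Reader

variable {𝔇 : TypeDomain.{u}} {S : Schema 𝔇}

/-- Membership in the answers of a query. If an answer variable is repeated, the components of the
tuple in question have to be compared, which is done by pins. -/
theorem realizable_ans (Q : Query S) (hQ : Q.body.IsUCQF) (w : 𝔇.InInsc Q.types) :
    Realizable 0 fun (I : S.Instance) σ => (decode σ).inTuple w ∈ Q.ans I := by
  classical
  set hd : Fin Q.types.length → Σ τ, 𝔇.NVar τ := fun i => ⟨Q.types.get i, Q.head i⟩ with hhd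
  set ρ : 𝔇.Ty → ℕ → ℕ := fun τ n => if h : ∃ i, hd i = ⟨τ, n⟩ then 4 * w h.choose else 0
    with hρ
  have hρ4 : ∀ τ n, ρ τ n % 4 = 2 → ρ τ n < 4 * 0 := by
    intro τ n h
    simp only [hρ] at h
    split_ifs at h
    all_goals omega
  have heq : Realizable 0 fun (_ : S.Instance) σ => ∀ p : {p : Fin Q.types.length ×
      Fin Q.types.length // hd p.1 = hd p.2},
      σ (Q.types.get p.1.1) (4 * w p.1.1) = σ (Q.types.get p.1.1) (4 * w p.1.2) := by
    refine Realizable.forall_finite fun p k hk => ?_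
    convert realizableAt_of_reader (S := S) (k := k)
      ⟨[], .tru, [⟨Q.types.get p.1.1, 4 * w p.1.1, .var (w p.1.2)⟩]⟩ ?_ using 3 with I σ
    · simp [Holds, Guard.Holds, Term.eval, Binding.onNormal, decode, XVar.code]
    · intro I σ σ' hσ
      simp only [Holds, Guard.Holds, Term.eval, Binding.onNormal, decode, XVar.code,
        List.mem_singleton, forall_eq]
      rintro ⟨-, -, h⟩
      refine ⟨by simp, trivial, ?_⟩
      rw [← hσ _ _ (by omega), ← hσ _ _ (by omega), h]
  have had : Realizable 0 fun (I : S.Instance) σ => ∀ i : Fin Q.types.length,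
      σ (Q.types.get i) (4 * w i) ∈ S.adom I (Q.types.get i) :=
    Realizable.forall_finite fun i => realizable_adom (by omega)
  convert heq.and (had.and (realizable_isUCQF hQ hρ4)) using 3 with I σ
  have hval : ∀ i, (decode σ).inTuple w i = σ (Q.types.get i) (4 * w i) := fun i => rfl
  simp only [Query.ans, Set.mem_ofPred_eq, hval]
  constructor
  · rintro ⟨θ, h1, h2⟩
    have hpair : ∀ i j, hd i = hd j →
        σ (Q.types.get i) (4 * w i) = σ (Q.types.get i) (4 * w j) := by
      intro i j hij
      have key : ∀ τ τ' (x : 𝔇.NVar τ) (x' : 𝔇.NVar τ') (n n' : ℕ),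
          (⟨τ, x⟩ : Σ τ, 𝔇.NVar τ) = ⟨τ', x'⟩ → θ τ x = σ τ n → θ τ' x' = σ τ' n' →
          σ τ n = σ τ n' := by
        rintro τ _ x _ n n' ⟨⟩ e e'
        rw [← e, ← e']
      exact key _ _ _ _ _ _ hij (h1 i).1 (h1 j).1
    refine ⟨fun p => hpair _ _ p.2, fun i => (h1 i).2, (FO.sat_congr ?_).1 h2⟩
    rintro v hv
    obtain ⟨i, rfl⟩ := Q.free_sub v hv
    have hex : ∃ j, hd j = ⟨Q.types.get i, Q.head i⟩ := ⟨i, rfl⟩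
    simp only [hρ, dif_pos hex]
    rw [(h1 i).1]
    exact hpair _ _ hex.choose_spec.symm
  · rintro ⟨h1, h2, h3⟩
    refine ⟨_, fun i => ⟨?_, h2 i⟩, h3⟩
    have hex : ∃ j, hd j = ⟨Q.types.get i, Q.head i⟩ := ⟨i, rfl⟩
    simp only [hρ, dif_pos hex]
    exact (h1 ⟨(i, hex.choose), hex.choose_spec.symm⟩).symm

end Reader

/-! ### Transitions of a DB-net in unfolded form -/

namespace TypeDomain

variable {𝔇 : TypeDomain.{u}}

theorem outVars_finite {c : 𝔇.Color} (w : 𝔇.OutInsc c) : (𝔇.outVars w).Finite := by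
  have : 𝔇.outVars w ⊆ ⋃ i, {v | (⟨c.get i, w i⟩ : Σ τ, Term 𝔇 𝔇.XVar τ) = ⟨v.1, .var v.2⟩} := by
    rintro v ⟨i, hi⟩
    exact Set.mem_iUnion.2 ⟨i, hi⟩
  refine (Set.finite_iUnion fun i => Set.Subsingleton.finite ?_).subset this
  rintro ⟨τ, v⟩ hv ⟨τ', v'⟩ hv'
  have := hv.symm.trans hv'
  cases this
  rfl

end TypeDomain

theorem NuCPN.flowVars_finite {𝔇 : TypeDomain.{u}} {P : Type} [Finite P] {color : P → 𝔇.Color}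
    {T : Type} (F : T → (p : P) → Multiset (𝔇.OutInsc (color p))) (t : T) :
    (NuCPN.flowVars F t).Finite := by
  have : NuCPN.flowVars F t ⊆ ⋃ p, ⋃ w ∈ {w | w ∈ F t p}, 𝔇.outVars w := by
    rintro v ⟨p, w, hw, hv⟩
    simp only [Set.mem_iUnion]
    exact ⟨p, w, hw, hv⟩
  refine (Set.finite_iUnion fun p => ?_).subset this
  exact Set.Finite.biUnion (Multiset.finite_toSet _) fun w _ => outVars_finite w

namespace DBNet

variable (B : DBNet.{u})

theorem outVars_finite (t : B.control.Trans) : (B.outVars t).Finite := by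
  have := B.control.net.finite_places
  refine ((NuCPN.flowVars_finite _ t).union (NuCPN.flowVars_finite _ t)).union ?_
  cases h : B.control.act t with
  | none => simp
  | some x => simpa using TypeDomain.outVars_finite x.2

/-- What a transition `t` does to the database and what it reads from it, in unfolded form: the
facts that its action deletes and adds, as inscriptions of relation places, and the alternatives
for reading its view places as readers. -/
structure Unfolding (t : B.control.Trans) where
  n : ℕ
  rel : Fin n → B.persistence.schema.Rel
  args : (f : Fin n) → B.domain.OutInsc (B.persistence.schema.sig (rel f))
  args_vars : ∀ f, B.domain.outVars (args f) ⊆ B.outVars t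
  add : Finset (Fin n)
  del : Finset (Fin n)
  mem_updated : ∀ I (σ : B.domain.Binding) x, x ∈ B.updated I t σ ↔
    (x ∈ I ∧ ∀ f ∈ del, x ≠ ⟨rel f, σ.outTuple (args f)⟩) ∨
      ∃ f ∈ add, x = ⟨rel f, σ.outTuple (args f)⟩
  readers : List (Reader B.persistence.schema)
  readers_ne : readers ≠ []
  views : ∀ I (σ : B.domain.Assignment B.domain.NVar),
    (∀ v, ∀ w ∈ B.control.viewRead v t,
      (decode σ).inTuple w ∈ (B.logic.query (B.control.query v)).ans I) ↔
    ∃ σ', AgreeBelow 0 σ σ' ∧ ∃ r ∈ readers, r.Holds I σ'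

theorem exists_readers (hQ : ∀ q : B.logic.Qry, (B.logic.query q).body.IsUCQF)
    (t : B.control.Trans) :
    ∃ L : List (Reader B.persistence.schema), L ≠ [] ∧
      ∀ I (σ : B.domain.Assignment B.domain.NVar),
        (∀ v, ∀ w ∈ B.control.viewRead v t,
          (decode σ).inTuple w ∈ (B.logic.query (B.control.query v)).ans I) ↔
        ∃ σ', AgreeBelow 0 σ σ' ∧ ∃ r ∈ L, r.Holds I σ' := by
  have := B.control.finite_view
  have h : Reader.Realizable 0 fun (I : B.persistence.schema.Instance) σ =>
      ∀ v, ∀ w ∈ (B.control.viewRead v t).toList,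
        (decode σ).inTuple w ∈ (B.logic.query (B.control.query v)).ans I :=
    Reader.Realizable.forall_finite fun v => Reader.Realizable.forall_mem _ fun w _ =>
      Reader.realizable_ans _ (hQ _) w
  obtain ⟨_, -, L, -, hL⟩ := h 0 le_rfl
  -- An unsatisfiable reader ensures that every transition has at least one copy.
  refine ⟨⟨[], .not .tru, []⟩ :: L, by simp, fun I σ => ?_⟩
  simp only [Multiset.mem_toList] at hL
  simp [hL, Reader.Holds, Guard.Holds]

end DBNet

/-- The arguments of a fact template, with the terms of an action inscription substituted for the
parameters. -/
def FactTemplate.subst {𝔇 : TypeDomain.{u}} {S : Schema 𝔇} {params : 𝔇.Color}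
    (f : FactTemplate S params) (w : 𝔇.OutInsc params) : 𝔇.OutInsc (S.sig f.rel) :=
  fun i => match f.args i with
    | .var k => k.2 ▸ w k.1
    | .val o => .val o

theorem FactTemplate.ground_eq {𝔇 : TypeDomain.{u}} {S : Schema 𝔇} {params : 𝔇.Color}
    (f : FactTemplate S params) (w : 𝔇.OutInsc params) (σ : 𝔇.Binding) :
    f.ground (σ.outTuple w) = ⟨f.rel, σ.outTuple (f.subst w)⟩ := by
  have key : ∀ τ τ' (e : τ = τ') (z : Term 𝔇 𝔇.XVar τ),
      (e ▸ z.eval σ : 𝔇.Dom τ') = Term.eval σ (e ▸ z : Term 𝔇 𝔇.XVar τ') := by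
    rintro τ _ rfl z
    rfl
  simp only [FactTemplate.ground]
  congr 1
  funext i
  simp only [Binding.outTuple, FactTemplate.subst]
  cases h : f.args i with
  | var k => exact key _ _ _ _
  | val o => rfl

theorem FactTemplate.outVars_subst {𝔇 : TypeDomain.{u}} {S : Schema 𝔇} {params : 𝔇.Color}
    (f : FactTemplate S params) (w : 𝔇.OutInsc params) :
    𝔇.outVars (f.subst w) ⊆ 𝔇.outVars w := by
  have key : ∀ τ τ' (e : τ = τ') (z : Term 𝔇 𝔇.XVar τ),
      (⟨τ', e ▸ z⟩ : Σ τ, Term 𝔇 𝔇.XVar τ) = ⟨τ, z⟩ := by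
    rintro τ _ rfl z
    rfl
  rintro v ⟨i, hi⟩
  simp only [FactTemplate.subst] at hi
  cases h : f.args i with
  | var k =>
    rw [h] at hi
    exact ⟨k.1, (key _ _ k.2 _).symm.trans hi⟩
  | val o =>
    rw [h] at hi
    obtain ⟨τ, v⟩ := v
    simp only [Sigma.mk.injEq] at hi
    obtain ⟨rfl, hi⟩ := hi
    simp at hi

theorem DBNet.nonempty_unfolding (B : DBNet.{u})
    (hQ : ∀ q : B.logic.Qry, (B.logic.query q).body.IsUCQF) (t : B.control.Trans) :
    Nonempty (B.Unfolding t) := by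
  classical
  obtain ⟨L, hL, hviews⟩ := B.exists_readers hQ t
  cases h : B.control.act t with
  | none =>
    exact ⟨⟨0, Fin.elim0, fun f => f.elim0, fun f => f.elim0, ∅, ∅, by simp [DBNet.updated, h], L, hL, hviews⟩⟩
  | some x =>
    obtain ⟨α, w⟩ := x
    set F := (B.logic.action α).add ∪ (B.logic.action α).del with hF
    set e := F.equivFin.symm with he
    have hsurj : ∀ g ∈ F, ∃ f, (e f).1 = g := fun g hg => ⟨e.symm ⟨g, hg⟩, by simp⟩
    refine ⟨⟨F.card, fun f => (e f).1.rel, fun f => (e f).1.subst w, fun f => ?_,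
      {f | (e f).1 ∈ (B.logic.action α).add}, {f | (e f).1 ∈ (B.logic.action α).del},
      fun I σ x => ?_, L, hL, hviews⟩⟩
    · refine ((e f).1.outVars_subst w).trans fun v hv => Or.inr ⟨_, h, hv⟩
    · simp only [DBNet.updated, h, DBAction.apply, Finset.mem_union, Finset.mem_sdiff,
        Finset.mem_image, Finset.mem_filter, Finset.mem_univ, true_and, ← FactTemplate.ground_eq]
      refine or_congr (and_congr_right fun _ => ?_) ?_
      · constructor
        · rintro h f hf rfl
          exact h ⟨_, hf, rfl⟩
        · rintro h ⟨g, hg, rfl⟩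
          obtain ⟨f, rfl⟩ := hsurj g (Finset.mem_union_right _ hg)
          exact h f hg rfl
      · constructor
        · rintro ⟨g, hg, rfl⟩
          obtain ⟨f, rfl⟩ := hsurj g (Finset.mem_union_left _ hg)
          exact ⟨f, hg, rfl⟩
        · rintro ⟨f, hf, rfl⟩
          exact ⟨_, hf, rfl⟩

/-! ### Tuples indexed by a finite type of slots -/

namespace TypeDomain

variable {𝔇 : TypeDomain.{u}} {ι : Type} [Finite ι] (typ : ι → 𝔇.Ty)

/-- The color of tuples with one component for each slot. -/
noncomputable def packColor : 𝔇.Color :=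
  List.ofFn fun i : Fin (Nat.card ι) => typ ((Finite.equivFin ι).symm i)

/-- The slot of a position. -/
noncomputable def slotAt (i : Fin (packColor typ).length) : ι :=
  (Finite.equivFin ι).symm (i.cast List.length_ofFn)

theorem typ_slotAt (i : Fin (packColor typ).length) :
    typ (slotAt typ i) = (packColor typ).get i := by
  exact (List.get_ofFn (fun i => typ ((Finite.equivFin ι).symm i)) i).symm

theorem slotAt_surjective : Function.Surjective (slotAt typ) := fun s =>
  ⟨(Finite.equivFin ι s).cast List.length_ofFn.symm,
    (Finite.equivFin ι).symm_apply_apply s⟩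

/-- The tuple of the variables `x s`, one for each slot `s`. -/
noncomputable def packIn (x : ι → ℕ) : 𝔇.InInsc (packColor typ) := fun i => x (slotAt typ i)

/-- The tuple of the terms `z s`, one for each slot `s`. -/
noncomputable def packOut (z : ∀ s, Term 𝔇 𝔇.XVar (typ s)) : 𝔇.OutInsc (packColor typ) :=
  fun i => typ_slotAt typ i ▸ z (slotAt typ i)

variable {typ}

theorem inTuple_packIn_eq_iff {x : ι → ℕ} {z : ∀ s, Term 𝔇 𝔇.XVar (typ s)} {σ σ' : 𝔇.Binding} :
    σ.inTuple (packIn typ x) = σ'.outTuple (packOut typ z) ↔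
      ∀ s, σ.onNormal (typ s) (x s) = (z s).eval σ' := by
  have key : ∀ τ τ' (e : τ = τ') (n : ℕ) (z : Term 𝔇 𝔇.XVar τ),
      σ.onNormal τ' n = Term.eval σ' (e ▸ z : Term 𝔇 𝔇.XVar τ') ↔
        σ.onNormal τ n = z.eval σ' := by
    rintro τ _ rfl n z
    rfl
  rw [funext_iff, (slotAt_surjective typ).forall]
  exact forall_congr' fun i => key _ _ (typ_slotAt typ i) _ _

theorem mem_outVars_packOut {z : ∀ s, Term 𝔇 𝔇.XVar (typ s)} {v : Σ τ, XVar 𝔇 τ} :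
    v ∈ 𝔇.outVars (packOut typ z) ↔
      ∃ s, (⟨typ s, z s⟩ : Σ τ, Term 𝔇 𝔇.XVar τ) = ⟨v.1, .var v.2⟩ := by
  have key : ∀ τ τ' (e : τ = τ') (z : Term 𝔇 𝔇.XVar τ),
      (⟨τ', e ▸ z⟩ : Σ τ, Term 𝔇 𝔇.XVar τ) = ⟨τ, z⟩ := by
    rintro τ _ rfl z
    rfl
  rw [(slotAt_surjective typ).exists]
  refine exists_congr fun i => ?_
  rw [← key _ _ (typ_slotAt typ i) (z (slotAt typ i))]
  rfl

end TypeDomain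

/-! ### Nets that carry a single auxiliary token -/

namespace DBNet

variable {B : DBNet.{u}} {K : Type} {auxColor : K → B.domain.Color}

/-- A transition of a net over control places, relation places and the auxiliary places `K` that
moves a single auxiliary token from the place `src` to the place `dst`. -/
structure EncTrans (B : DBNet.{u}) {K : Type} (auxColor : K → B.domain.Color) where
  ctrlIn : (p : B.control.CtrlPlace) → Multiset (B.domain.InInsc (B.control.color p))
  ctrlRead : (p : B.control.CtrlPlace) → Multiset (B.domain.InInsc (B.control.color p))
  ctrlOut : (p : B.control.CtrlPlace) → Multiset (B.domain.OutInsc (B.control.color p))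
  relIn : (R : B.persistence.schema.Rel) → Multiset (B.domain.InInsc (B.persistence.schema.sig R))
  relRead : (R : B.persistence.schema.Rel) →
    Multiset (B.domain.InInsc (B.persistence.schema.sig R))
  relOut : (R : B.persistence.schema.Rel) →
    Multiset (B.domain.OutInsc (B.persistence.schema.sig R))
  guard : Guard B.domain
  src : K
  srcInsc : B.domain.InInsc (auxColor src)
  dst : K
  dstInsc : B.domain.OutInsc (auxColor dst)
  prio : ℕ

open scoped Classical in
/-- The net with the given transitions. -/
noncomputable def EncTrans.net {T : Type} [Finite T] [Finite K] (e : T → EncTrans B auxColor) :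
    PrioNuCPN B.domain (B.encColor auxColor) T where
  finite_places :=
    have := B.control.net.finite_places
    have := B.persistence.schema.finite_rel
    inferInstance
  finite_trans := inferInstance
  inFlow := fun p t => match p with
    | .inl p => (e t).ctrlIn p
    | .inr (.inl R) => (e t).relIn R
    | .inr (.inr k) => Pi.single (M := fun k => Multiset (B.domain.InInsc (auxColor k)))
        (e t).src {(e t).srcInsc} k
  readFlow := fun p t => match p with
    | .inl p => (e t).ctrlRead p
    | .inr (.inl R) => (e t).relRead R
    | .inr (.inr _) => 0
  guard := fun t => (e t).guard
  outFlow := fun t p => match p with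
    | .inl p => (e t).ctrlOut p
    | .inr (.inl R) => (e t).relOut R
    | .inr (.inr k) => Pi.single (M := fun k => Multiset (B.domain.OutInsc (auxColor k)))
        (e t).dst {(e t).dstInsc} k
  prio := fun t => (e t).prio

/-- The tokens on a control place. -/
abbrev ctrlPart (M : Marking B.domain (B.encColor auxColor)) (p : B.control.CtrlPlace) :
    Multiset (B.domain.Tuple (B.control.color p)) := M (.inl p)

/-- The tokens on a relation place. -/
abbrev relPart (M : Marking B.domain (B.encColor auxColor)) (R : B.persistence.schema.Rel) :
    Multiset (B.domain.Tuple (B.persistence.schema.sig R)) := M (.inr (.inl R))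

/-- The tokens on an auxiliary place. -/
abbrev auxPart (M : Marking B.domain (B.encColor auxColor)) (k : K) :
    Multiset (B.domain.Tuple (auxColor k)) := M (.inr (.inr k))

open scoped Classical in
/-- The only auxiliary token of the marking is `x.2`, on the place `x.1`. -/
def AuxAt (M : Marking B.domain (B.encColor auxColor)) (x : Σ k, B.domain.Tuple (auxColor k)) :
    Prop :=
  ∀ k, auxPart M k = Pi.single (M := fun k => Multiset (B.domain.Tuple (auxColor k)))
    x.1 {x.2} k

theorem auxAt_of_forall {K : Type} {auxColor : K → B.domain.Color}
    {M : Marking B.domain (B.encColor auxColor)} {x : Σ k, B.domain.Tuple (auxColor k)}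
    (h₁ : auxPart M x.1 = {x.2}) (h₂ : ∀ k ≠ x.1, auxPart M k = 0) : AuxAt M x := by
  classical
  intro k
  by_cases h : k = x.1
  · subst h
    rw [h₁, Pi.single_eq_same]
  · rw [h₂ k h, Pi.single_eq_of_ne h]

open scoped Classical in
theorem map_single {A C : K → Type*} (f : ∀ k, A k → C k) (i : K) (a : A i) (k : K) :
    (Pi.single (M := fun k => Multiset (A k)) i {a} k).map (f k) =
      Pi.single (M := fun k => Multiset (C k)) i {f i a} k := by
  by_cases h : k = i
  · subst h
    simp
  · simp [Pi.single_eq_of_ne h]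

open scoped Classical in
theorem single_le_single_iff {A : K → Type*} {x y : Σ k, A k} :
    (∀ k, Pi.single (M := fun k => Multiset (A k)) x.1 {x.2} k ≤
      Pi.single (M := fun k => Multiset (A k)) y.1 {y.2} k) ↔ x = y := by
  constructor
  · intro h
    obtain ⟨i, a⟩ := x
    obtain ⟨j, b⟩ := y
    have := h i
    by_cases hij : i = j
    · subst hij
      simpa [Multiset.singleton_le] using this
    · simp [Pi.single_eq_of_ne hij] at this
  · rintro rfl k
    exact le_rfl

namespace EncTrans

variable {T : Type} [Finite T] [Finite K] {e : T → EncTrans B auxColor}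
  {M M' : Marking B.domain (B.encColor auxColor)} {x : Σ k, B.domain.Tuple (auxColor k)}
  {t : T} {σ : B.domain.Binding}

theorem ready_iff (hM : AuxAt M x) : (net e).Ready M t σ ↔
    (⟨(e t).src, σ.inTuple (e t).srcInsc⟩ : Σ k, B.domain.Tuple (auxColor k)) = x ∧
    (∀ p, ((e t).ctrlIn p).map σ.inTuple ≤ ctrlPart M p) ∧
    (∀ p, ∀ w ∈ (e t).ctrlRead p, σ.inTuple w ∈ ctrlPart M p) ∧
    (∀ R, ((e t).relIn R).map σ.inTuple ≤ relPart M R) ∧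
    (∀ R, ∀ w ∈ (e t).relRead R, σ.inTuple w ∈ relPart M R) ∧
    (e t).guard.Holds σ.onNormal := by
  classical
  rw [← single_le_single_iff]
  have key : (∀ k, (Pi.single (M := fun k => Multiset (B.domain.InInsc (auxColor k)))
      (e t).src {(e t).srcInsc} k).map σ.inTuple ≤ auxPart M k) ↔
      ∀ k, Pi.single (M := fun k => Multiset (B.domain.Tuple (auxColor k)))
        (e t).src {σ.inTuple (e t).srcInsc} k ≤ Pi.single (M := fun k =>
          Multiset (B.domain.Tuple (auxColor k))) x.1 {x.2} k :=
    forall_congr' fun k => by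
      rw [hM k, map_single (fun k w => (σ.inTuple w : B.domain.Tuple (auxColor k)))]
  constructor
  · rintro ⟨h1, h2, h3⟩
    exact ⟨key.1 fun k => h1 (.inr (.inr k)), fun p => h1 (.inl p), fun p => h2 (.inl p),
      fun R => h1 (.inr (.inl R)), fun R => h2 (.inr (.inl R)), h3⟩
  · rintro ⟨h1, h2, h3, h4, h5, h6⟩
    refine ⟨?_, ?_, h6⟩
    · rintro (p | R | k)
      · exact h2 p
      · exact h4 R
      · exact key.2 h1 k
    · rintro (p | R | k)
      · exact h3 p
      · exact h5 R
      · exact fun w hw => absurd hw (Multiset.notMem_zero w)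

theorem moves_iff (hM : AuxAt M x)
    (hx : (⟨(e t).src, σ.inTuple (e t).srcInsc⟩ : Σ k, B.domain.Tuple (auxColor k)) = x) :
    (net e).Moves (net e).outFlow M t σ M' ↔
    (∀ p, ctrlPart M' p + ((e t).ctrlIn p).map σ.inTuple =
      ctrlPart M p + ((e t).ctrlOut p).map σ.outTuple) ∧
    (∀ R, relPart M' R + ((e t).relIn R).map σ.inTuple =
      relPart M R + ((e t).relOut R).map σ.outTuple) ∧
    AuxAt M' ⟨(e t).dst, σ.outTuple (e t).dstInsc⟩ := by
  classical
  subst hx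
  have key : (∀ k, auxPart M' k +
      (Pi.single (M := fun k => Multiset (B.domain.InInsc (auxColor k)))
        (e t).src {(e t).srcInsc} k).map σ.inTuple = auxPart M k +
      (Pi.single (M := fun k => Multiset (B.domain.OutInsc (auxColor k)))
        (e t).dst {(e t).dstInsc} k).map σ.outTuple) ↔
      AuxAt M' ⟨(e t).dst, σ.outTuple (e t).dstInsc⟩ :=
    forall_congr' fun k => by
      rw [hM k, map_single (fun k w => (σ.inTuple w : B.domain.Tuple (auxColor k))),
        map_single (fun k w => (σ.outTuple w : B.domain.Tuple (auxColor k))), add_comm]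
      exact add_right_inj _
  constructor
  · intro h
    exact ⟨fun p => h (.inl p), fun R => h (.inr (.inl R)), key.1 fun k => h (.inr (.inr k))⟩
  · rintro ⟨h1, h2, h3⟩ (p | R | k)
    · exact h1 p
    · exact h2 R
    · exact key.2 h3 k

end EncTrans

end DBNet

theorem NuCPN.Ready.exists_moves {𝔇 : TypeDomain.{u}} {P : Type} {color : P → 𝔇.Color} {T : Type}
    {N : NuCPN 𝔇 color T} {M : Marking 𝔇 color} {t : T} {σ : 𝔇.Binding} (h : N.Ready M t σ) :
    ∃ M', N.Moves N.outFlow M t σ M' := by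
  classical
  refine ⟨fun p => M p - (N.inFlow p t).map σ.inTuple + (N.outFlow t p).map σ.outTuple,
    fun p => ?_⟩
  dsimp only
  rw [add_right_comm, Multiset.sub_add_cancel (h.1 p)]

/-! ### The encoding -/

namespace DBNet.Unfolding

variable {B : DBNet.{u}} {t : B.control.Trans} (x : B.Unfolding t)

/-- The `f`-th fact of the action. -/
def fact (σ : B.domain.Binding) (f : Fin x.n) : B.persistence.schema.Fact :=
  ⟨x.rel f, σ.outTuple (x.args f)⟩

/-- The data that distinguish the copies of a transition: which facts of its action are equal,
given by representatives, which representatives are present in the database, and the alternative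
by which view places are read. -/
structure Choice where
  rep : Fin x.n → Fin x.n
  rep_rep : ∀ f, rep (rep f) = rep f
  rel_rep : ∀ f, x.rel (rep f) = x.rel f
  present : Finset (Fin x.n)
  rep_present : ∀ f ∈ present, rep f = f
  alt : Fin x.readers.length

instance : Finite x.Choice :=
  Finite.of_injective (fun d => (d.rep, d.present, d.alt)) <| by
    rintro ⟨⟩ ⟨⟩ h
    simp only [Prod.mk.injEq] at h
    obtain ⟨rfl, rfl, rfl⟩ := h
    rfl

instance : Nonempty x.Choice :=
  ⟨⟨id, fun _ => rfl, fun _ => rfl, ∅, by simp, ⟨0, List.length_pos_of_ne_nil x.readers_ne⟩⟩⟩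

variable {x}

namespace Choice

variable (d : x.Choice)

/-- The chosen alternative for reading the view places. -/
def reader : Reader B.persistence.schema := x.readers.get d.alt

/-- The representatives that are present after the update. -/
noncomputable def after : Finset (Fin x.n) :=
  open scoped Classical in x.add.image d.rep ∪ (d.present \ x.del.image d.rep)

/-- The components of an auxiliary token: the output variables of the transition, the components
of the facts of its action, and two components for each pin of the reader. -/
abbrev Slot : Type :=
  B.outVars t ⊕ (Σ f, Fin (B.persistence.schema.sig (x.rel f)).length) ⊕
    (Fin d.reader.pins.length × Bool)

instance : Finite d.Slot :=
  have := (B.outVars_finite t).to_subtype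
  inferInstance

/-- The type of a component of an auxiliary token. -/
def slotTy : d.Slot → B.domain.Ty
  | .inl v => v.1.1
  | .inr (.inl s) => (B.persistence.schema.sig (x.rel s.1)).get s.2
  | .inr (.inr s) => (d.reader.pins.get s.1).1

/-- The inscription by which a token is produced. -/
def slotTerm : (s : d.Slot) → Term B.domain B.domain.XVar (d.slotTy s)
  | .inl v => .var v.1.2
  | .inr (.inl s) => x.args s.1 s.2
  | .inr (.inr s) => (d.reader.pins.get s.1).2.2.rename fun _ n => XVar.normal n

/-- The variable for the `i`-th component of the `f`-th fact. -/
def factVar (f i : ℕ) : ℕ := 4 * Nat.pair f i + 3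

/-- An inscription by which a token is consumed when the guess is withdrawn. The components of pins
get variables of their own, so that nothing is required of them; facts are identified along `ρ`. -/
def testVar (ρ : ℕ → ℕ) : d.Slot → ℕ
  | .inl v => v.1.2.code
  | .inr (.inl s) => factVar (ρ s.1) s.2
  | .inr (.inr s) => 4 * Nat.pair s.1 s.2.toNat + 2

/-- The variable of the DB-net, if any, to which a pin refers; otherwise, the pinned variable. -/
def linkVar (y : Σ τ, ℕ × Term B.domain B.domain.NVar τ) : ℕ :=
  match y.2.2 with
  | .var n => XVar.code (.normal n : XVar B.domain y.1)
  | .val _ => y.2.1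

/-- The inscription by which a token is consumed when the transition fires. Facts are identified
as the choice demands. The two components of a pin make both of its sides equal to the guessed
value. -/
def fireVar : d.Slot → ℕ
  | .inl v => v.1.2.code
  | .inr (.inl s) => factVar (d.rep s.1) s.2
  | .inr (.inr (j, false)) => (d.reader.pins.get j).2.1
  | .inr (.inr (j, true)) => linkVar (d.reader.pins.get j)

/-- The color of the auxiliary tokens for a choice. -/
noncomputable abbrev tokColor : B.domain.Color := packColor d.slotTy

/-- The auxiliary token for a choice and a binding. -/
noncomputable def tok (σ : B.domain.Binding) : B.domain.Tuple d.tokColor :=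
  σ.outTuple (packOut d.slotTy d.slotTerm)

/-- The silent transitions for a choice. -/
inductive AuxOp : Type
  /-- A binding is guessed and stored in an auxiliary token. -/
  | guess : AuxOp
  /-- The guess is withdrawn. -/
  | undo : AuxOp
  /-- The guess is withdrawn because two facts are equal, against the choice. -/
  | clash (f g : Fin x.n) (hrel : x.rel f = x.rel g) (hrep : d.rep f ≠ d.rep g) : AuxOp
  /-- The guess is withdrawn because a fact is present, against the choice. -/
  | found (f : Fin x.n) (hrep : d.rep f = f) (hf : f ∉ d.present) : AuxOp

instance : Finite d.AuxOp :=
  Finite.of_injective (β := Option (Option (Fin x.n × Fin x.n ⊕ Fin x.n)))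
    (fun
      | .guess => none
      | .undo => some none
      | .clash f g _ _ => some (some (.inl (f, g)))
      | .found f _ _ => some (some (.inr f))) <| by
    rintro (_ | _ | _ | _) (_ | _ | _ | _) h <;> simp_all

end Choice

end DBNet.Unfolding

namespace DBNet

variable {B : DBNet.{u}}

section

variable (X : ∀ t, B.Unfolding t)

/-- A transition together with a choice. -/
abbrev Key : Type := Σ t, (X t).Choice

/-- The place `none` holds a token without components as long as nothing is guessed. -/
noncomputable def tokenColor : Option (Key X) → B.domain.Color
  | none => []
  | some κ => κ.2.tokColor

instance : Finite (Key X) :=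
  have := B.control.net.finite_trans
  inferInstance

end

variable {X : ∀ t, B.Unfolding t}

open Unfolding.Choice (factVar)

open scoped Classical in
/-- The visible transition for a choice. -/
noncomputable def fireTrans (κ : Key X) : EncTrans B (tokenColor X) where
  ctrlIn := fun p => (B.control.net.inFlow p κ.1).map fun w i =>
    XVar.code (.normal (w i) : XVar B.domain ((B.control.color p).get i))
  ctrlRead := fun p => (B.control.net.readFlow p κ.1).map fun w i =>
    XVar.code (.normal (w i) : XVar B.domain ((B.control.color p).get i))
  ctrlOut := fun p => (B.control.net.outFlow κ.1 p).map fun w i =>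
    (w i).rename fun _ v => .normal v.code
  relIn := fun R => ({f ∈ κ.2.present | (X κ.1).rel f = R} : Finset _).val.map
    fun (f : Fin _) i => factVar f i
  relRead := fun R => (Multiset.ofList (κ.2.reader.reads.filter fun y => y.1 = R)).map fun y i =>
    y.2 i.1
  relOut := fun R => ({f ∈ κ.2.after | (X κ.1).rel f = R} : Finset _).val.map
    fun (f : Fin _) i => .var (.normal (factVar f i))
  guard := ((B.control.net.guard κ.1).rename fun τ n =>
    XVar.code (.normal n : XVar B.domain τ)).and κ.2.reader.guard
  src := some κ
  srcInsc := packIn κ.2.slotTy κ.2.fireVar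
  dst := none
  dstInsc := fun i => i.elim0
  prio := 0

/-- A transition that only reads relation places and moves the auxiliary token. -/
def silentTrans (src : Option (Key X)) (srcInsc : B.domain.InInsc (tokenColor X src))
    (dst : Option (Key X)) (dstInsc : B.domain.OutInsc (tokenColor X dst))
    (relRead : (R : B.persistence.schema.Rel) →
      Multiset (B.domain.InInsc (B.persistence.schema.sig R))) (prio : ℕ) :
    EncTrans B (tokenColor X) :=
  ⟨0, 0, 0, 0, relRead, 0, .tru, src, srcInsc, dst, dstInsc, prio⟩

open scoped Classical in
/-- The silent transition for an operation. Those that detect a wrong guess have priority over all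
others. -/
noncomputable def auxTrans (κ : Key X) : κ.2.AuxOp → EncTrans B (tokenColor X)
  | .guess => silentTrans none (fun i => i.elim0) (some κ) (packOut _ κ.2.slotTerm) 0 0
  | .undo => silentTrans (some κ) (packIn _ (κ.2.testVar id)) none (fun i => i.elim0) 0 0
  | .clash f g _ _ => silentTrans (some κ)
      (packIn _ (κ.2.testVar fun h => if h = g.1 then f.1 else h)) none (fun i => i.elim0) 0 1
  | .found f _ _ => silentTrans (some κ) (packIn _ (κ.2.testVar id)) none (fun i => i.elim0)
      (fun R => if (X κ.1).rel f = R then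
        ({fun i => factVar f i.1} : Multiset ((i : Fin _) → B.domain.NVar _)) else 0) 1

variable (X)

/-- All transitions of the encoding. -/
noncomputable def encTrans : Key X ⊕ (Σ κ : Key X, κ.2.AuxOp) → EncTrans B (tokenColor X) :=
  Sum.elim fireTrans fun a => auxTrans a.1 a.2

/-- The encoding of a DB-net. -/
noncomputable def encNet :
    PrioNuCPN B.domain (B.encColor (tokenColor X)) (Key X ⊕ (Σ κ : Key X, κ.2.AuxOp)) :=
  EncTrans.net (encTrans X)

end DBNet

/-! ### Auxiliary tokens -/

namespace TypeDomain

variable {𝔇 : TypeDomain.{u}}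

/-- A binding with prescribed values for normal variables. -/
def Binding.ofNormal (θ : 𝔇.Assignment 𝔇.NVar) : 𝔇.Binding
  | τ, .normal n => θ τ n
  | τ, .fresh _ _ => θ τ 0

theorem Binding.onNormal_ofNormal (θ : 𝔇.Assignment 𝔇.NVar) : (ofNormal θ).onNormal = θ := rfl

theorem Term.eval_congr {τ : 𝔇.Ty} {z : Term 𝔇 𝔇.XVar τ} {σ σ' : 𝔇.Binding}
    (h : ∀ x, z = .var x → σ τ x = σ' τ x) : z.eval σ = z.eval σ' := by
  cases z with
  | var x => exact h x rfl
  | val o => rfl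

theorem Binding.outTuple_congr {c : 𝔇.Color} {w : 𝔇.OutInsc c} {σ σ' : 𝔇.Binding}
    (h : ∀ v ∈ 𝔇.outVars w, σ v.1 v.2 = σ' v.1 v.2) : σ.outTuple w = σ'.outTuple w :=
  funext fun i => Term.eval_congr fun x hx => h ⟨_, x⟩ ⟨i, by rw [hx]⟩

theorem Binding.FreshFor.congr {σ σ' : 𝔇.Binding} {vars : Set (Σ τ, 𝔇.XVar τ)}
    {used : (τ : 𝔇.Ty) → Set (𝔇.Dom τ)} (h : σ.FreshFor vars used)
    (hσ : ∀ v ∈ vars, σ' v.1 v.2 = σ v.1 v.2) : σ'.FreshFor vars used := by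
  refine ⟨fun τ n hn hv => ?_, fun τ n n' hn hn' hv hv' he => ?_⟩
  · rw [hσ _ hv]
    exact h.1 τ n hn hv
  · rw [hσ _ hv, hσ _ hv'] at he
    exact h.2 τ n n' hn hn' hv hv' he

theorem Binding.FreshFor.mono {σ : 𝔇.Binding} {vars vars' : Set (Σ τ, 𝔇.XVar τ)}
    {used used' : (τ : 𝔇.Ty) → Set (𝔇.Dom τ)} (h : σ.FreshFor vars used) (hv : vars' ⊆ vars)
    (hu : ∀ τ, used' τ ⊆ used τ) : σ.FreshFor vars' used' :=
  ⟨fun τ n hn hx hx' => h.1 τ n hn (hv hx) (hu τ hx'),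
    fun τ n n' hn hn' hx hx' => h.2 τ n n' hn hn' (hv hx) (hv hx')⟩

theorem Binding.freshFor_of_forall_not_fresh (σ : 𝔇.Binding) {vars : Set (Σ τ, 𝔇.XVar τ)}
    (used : (τ : 𝔇.Ty) → Set (𝔇.Dom τ))
    (h : ∀ τ n hn, (⟨τ, .fresh n hn⟩ : Σ τ, 𝔇.XVar τ) ∉ vars) : σ.FreshFor vars used :=
  ⟨fun τ n hn hx => absurd hx (h τ n hn), fun τ n _ hn _ hx => absurd hx (h τ n hn)⟩

end TypeDomain

namespace DBNet.Unfolding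

variable {B : DBNet.{u}} {t : B.control.Trans} {x : B.Unfolding t}

open Choice (factVar)

theorem Choice.factVar_injective {f i f' i' : ℕ} (h : factVar f i = factVar f' i') :
    f = f' ∧ i = i' := by
  have : Nat.pair f i = Nat.pair f' i' := by simp only [factVar] at h; omega
  exact Nat.pair_eq_pair.1 this

variable (x) in
/-- The `f`-th fact, as given by the variables for its components. -/
def varFact (θ : B.domain.Assignment B.domain.NVar) (f : Fin x.n) : B.persistence.schema.Fact :=
  ⟨x.rel f, fun i => θ _ (factVar f i)⟩

variable (x) in
/-- Every binding of the variables of the DB-net is encoded by an assignment that also stores the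
facts of the action. -/
theorem exists_decode_eq (σ : B.domain.Binding) :
    ∃ θ, decode θ = σ ∧ ∀ f, x.varFact θ f = x.fact σ f := by
  obtain ⟨θ, -, h⟩ := exists_assignment_extending (𝔇 := B.domain)
    (ι := (Σ τ, XVar B.domain τ) ⊕ (Σ f, Fin (B.persistence.schema.sig (x.rel f)).length))
    (Sum.elim (fun v => v.1) fun s => (B.persistence.schema.sig (x.rel s.1)).get s.2)
    (Sum.elim (fun v => v.2.code) fun s => factVar s.1 s.2)
    (by
      rintro (⟨τ, v⟩ | ⟨f, i⟩) (⟨τ', v'⟩ | ⟨f', i'⟩) h h' <;>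
        simp only [Sum.elim_inl, Sum.elim_inr] at h h'
      · subst h
        rw [XVar.code_injective h']
      · have := v.code_mod
        simp only [factVar] at h'
        omega
      · have := v'.code_mod
        simp only [factVar] at h'
        omega
      · obtain ⟨h1, h2⟩ := Choice.factVar_injective h'
        obtain rfl := Fin.ext h1
        obtain rfl := Fin.ext h2
        rfl)
    (fun | .inl v => σ v.1 v.2 | .inr s => σ.outTuple (x.args s.1) s.2)
    (fun τ => Classical.choice ∘ fun _ => B.domain.nonempty_dom τ)
  refine ⟨θ, ?_, fun f => ?_⟩
  · funext τ v
    exact h (.inl ⟨τ, v⟩)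
  · simp only [varFact, fact]
    congr 1
    funext i
    exact h (.inr ⟨f, i⟩)

theorem fact_congr {σ σ' : B.domain.Binding}
    (h : ∀ v ∈ B.outVars t, σ v.1 v.2 = σ' v.1 v.2) (f : Fin x.n) : x.fact σ f = x.fact σ' f := by
  simp only [fact]
  rw [Binding.outTuple_congr fun v hv => h v (x.args_vars f hv)]

theorem mk_eq_mk_iff {θ : B.domain.Assignment B.domain.NVar} {R R' : B.persistence.schema.Rel}
    (e : R' = R) (v : ℕ → ℕ) (a : B.domain.Tuple (B.persistence.schema.sig R)) :
    (⟨R', fun i => θ _ (v i)⟩ : B.persistence.schema.Fact) = ⟨R, a⟩ ↔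
      ∀ i, θ ((B.persistence.schema.sig R).get i) (v i.1) = a i := by
  subst e
  simp [funext_iff]

namespace Choice

variable (d : x.Choice)

/-- A token can be consumed by a test that identifies equal facts only. -/
theorem exists_inTuple_testVar (σ : B.domain.Binding) (ρ : ℕ → ℕ)
    (hρ : ∀ f : Fin x.n, ∃ g : Fin x.n, ρ f = g ∧ x.fact σ g = x.fact σ f) :
    ∃ σ₁ : B.domain.Binding, σ₁.inTuple (packIn d.slotTy (d.testVar ρ)) = d.tok σ ∧
      ∀ f, x.varFact σ₁.onNormal f = x.fact σ f := by
  obtain ⟨θ, -, h⟩ := exists_assignment_extending d.slotTy (d.testVar id)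
    (by
      rintro (v | s | s) (v' | s' | s') h h' <;> simp only [slotTy, testVar, id] at h h'
      · obtain ⟨⟨τ, v⟩, hv⟩ := v
        obtain ⟨⟨τ', v'⟩, hv'⟩ := v'
        obtain rfl : τ = τ' := h
        obtain rfl := XVar.code_injective h'
        rfl
      · have := v.1.2.code_mod
        simp only [factVar] at h'
        omega
      · have := v.1.2.code_mod
        omega
      · have := v'.1.2.code_mod
        simp only [factVar] at h'
        omega
      · obtain ⟨h1, h2⟩ := factVar_injective h'
        obtain ⟨f, i⟩ := s
        obtain ⟨f', i'⟩ := s'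
        obtain rfl := Fin.ext h1
        obtain rfl := Fin.ext h2
        rfl
      · simp only [factVar] at h'
        omega
      · have := v'.1.2.code_mod
        omega
      · simp only [factVar] at h'
        omega
      · obtain ⟨h1, h2⟩ := Nat.pair_eq_pair.1
          (show Nat.pair s.1 s.2.toNat = Nat.pair s'.1 s'.2.toNat by omega)
        obtain ⟨j, b⟩ := s
        obtain ⟨j', b'⟩ := s'
        obtain rfl := Fin.ext h1
        obtain rfl : b = b' := by revert h2; cases b <;> cases b' <;> simp
        rfl)
    (fun s => (d.slotTerm s).eval σ)
    (fun τ => Classical.choice ∘ fun _ => B.domain.nonempty_dom τ)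
  have hfact : ∀ f, x.varFact θ f = x.fact σ f := fun f => by
    simp only [varFact, fact]
    congr 1
    funext i
    exact h (.inr (.inl ⟨f, i⟩))
  refine ⟨.ofNormal θ, inTuple_packIn_eq_iff.2 ?_, hfact⟩
  rw [Binding.onNormal_ofNormal]
  rintro (v | ⟨f, i⟩ | s)
  · exact h (.inl v)
  · obtain ⟨g, hg, hgf⟩ := hρ f
    simp only [testVar, hg]
    have := (hfact g).trans hgf
    exact (mk_eq_mk_iff (congrArg Sigma.fst hgf) _ _).1 this i
  · exact h (.inr (.inr s))

theorem fact_eq_of_inTuple_testVar {σ σ₁ : B.domain.Binding} {ρ : ℕ → ℕ}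
    (h : σ₁.inTuple (packIn d.slotTy (d.testVar ρ)) = d.tok σ) {f g : Fin x.n} (hg : ρ f = g)
    (hrel : x.rel g = x.rel f) : x.varFact σ₁.onNormal g = x.fact σ f := by
  refine (mk_eq_mk_iff hrel _ _).2 fun i => ?_
  have := inTuple_packIn_eq_iff.1 h (.inr (.inl ⟨f, i⟩))
  rw [← hg]
  exact this

/-- When the transition fires, the token fixes the values of the output variables. -/
theorem decode_eq_of_inTuple_fireVar {σ σ₁ : B.domain.Binding}
    (h : σ₁.inTuple (packIn d.slotTy d.fireVar) = d.tok σ) :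
    ∀ v ∈ B.outVars t, decode σ₁.onNormal v.1 v.2 = σ v.1 v.2 := fun v hv =>
  inTuple_packIn_eq_iff.1 h (.inl ⟨v, hv⟩)

/-- Since the second components of the pins pass on the variables to which the pins refer, the token is
the one for the binding under which the transition fires. -/
theorem tok_eq_of_inTuple_fireVar {σ σ₁ : B.domain.Binding}
    (h : σ₁.inTuple (packIn d.slotTy d.fireVar) = d.tok σ) :
    d.tok (decode σ₁.onNormal) = d.tok σ := by
  have hv := d.decode_eq_of_inTuple_fireVar h
  refine Binding.outTuple_congr fun v hmem => ?_
  obtain ⟨s, hs⟩ := mem_outVars_packOut.1 hmem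
  rcases s with w | ⟨f, i⟩ | ⟨j, b⟩
  · have : w.1 = v := by
      obtain ⟨⟨τ, w⟩, hw⟩ := w
      obtain ⟨τ', v⟩ := v
      simp only [slotTy, slotTerm] at hs
      cases hs
      rfl
    exact this ▸ hv _ w.2
  · exact hv _ (x.args_vars f ⟨i, hs⟩)
  · have h' := inTuple_packIn_eq_iff.1 h (.inr (.inr (j, true)))
    simp only [slotTy, slotTerm, fireVar] at hs h'
    generalize d.reader.pins.get j = y at hs h'
    obtain ⟨τ, n, z⟩ := y
    obtain ⟨τ', v⟩ := v
    cases z with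
    | var m =>
      simp only [Term.rename] at hs
      cases hs
      exact h'
    | val o =>
      simp only [Term.rename] at hs
      have := congrArg Sigma.fst hs
      simp only at this
      subst this
      simp at hs

/-- Consuming a token verifies the equalities of the choice and the pins of the reader. -/
theorem inTuple_fireVar_eq_tok_iff {σ₁ : B.domain.Binding} :
    σ₁.inTuple (packIn d.slotTy d.fireVar) = d.tok (decode σ₁.onNormal) ↔
      (∀ f, x.varFact σ₁.onNormal (d.rep f) = x.fact (decode σ₁.onNormal) f) ∧
      ∀ y ∈ d.reader.pins, σ₁.onNormal y.1 y.2.1 =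
        y.2.2.eval (decode σ₁.onNormal).onNormal := by
  have hpin : ∀ y : Σ τ, ℕ × Term B.domain B.domain.NVar τ,
      Term.eval (decode σ₁.onNormal) (y.2.2.rename fun _ n => XVar.normal n) =
        y.2.2.eval (decode σ₁.onNormal).onNormal := fun y => Term.eval_rename _ _ _
  constructor
  · intro h
    refine ⟨fun f => (mk_eq_mk_iff (d.rel_rep f) _ _).2 fun i =>
      inTuple_packIn_eq_iff.1 h (.inr (.inl ⟨f, i⟩)), fun y hy => ?_⟩
    obtain ⟨j, rfl⟩ := List.get_of_mem hy
    exact (inTuple_packIn_eq_iff.1 h (.inr (.inr (j, false)))).trans (hpin _)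
  · rintro ⟨h1, h2⟩
    refine inTuple_packIn_eq_iff.2 ?_
    rintro (v | ⟨f, i⟩ | ⟨j, b⟩)
    · rfl
    · exact (mk_eq_mk_iff (d.rel_rep f) _ _).1 (h1 f) i
    · have h3 := (h2 _ (List.get_mem d.reader.pins j)).trans (hpin _).symm
      cases b with
      | false => exact h3
      | true =>
        simp only [slotTy, slotTerm, fireVar] at h3 ⊢
        generalize d.reader.pins.get j = y at h3
        obtain ⟨τ, n, z⟩ := y
        cases z with
        | var m => rfl
        | val o => exact h3

end Choice

end DBNet.Unfolding

/-! ### Updating relation places -/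

/-- Replacing the elements `u f`, `f ∈ P`, of a multiset without repetitions by the elements `u f`,
`f ∈ A`. -/
theorem Multiset.nodup_and_mem_of_replace {α ι : Type*} {M M' : Multiset α} (hM : M.Nodup)
    {reps P A : Finset ι} {u : ι → α} (h : M' + P.val.map u = M + A.val.map u)
    (hinj : Set.InjOn u reps) (hP : P ⊆ reps) (hA : A ⊆ reps)
    (hmem : ∀ f ∈ reps, u f ∈ M ↔ f ∈ P) :
    M'.Nodup ∧ ∀ a, a ∈ M' ↔ (a ∈ M ∧ ∀ f ∈ P, u f ≠ a) ∨ ∃ f ∈ A, u f = a := by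
  classical
  have hnd : ∀ {Q : Finset ι}, Q ⊆ reps → (Q.val.map u).Nodup := fun {Q} hQ =>
    Multiset.Nodup.map_on (fun a ha b hb => hinj (hQ ha) (hQ hb)) Q.nodup
  have hle : P.val.map u ≤ M := by
    rw [Multiset.le_iff_subset (hnd hP)]
    intro a ha
    obtain ⟨f, hf, rfl⟩ := Multiset.mem_map.1 ha
    exact (hmem f (hP hf)).2 hf
  obtain ⟨M₀, rfl⟩ := Multiset.le_iff_exists_add.1 hle
  obtain ⟨-, hM₀, hdisj⟩ := Multiset.nodup_add.1 hM
  obtain rfl : M' = M₀ + A.val.map u := by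
    rw [add_comm (P.val.map u), add_right_comm] at h
    exact add_right_cancel h
  have hout : ∀ f ∈ reps, u f ∉ M₀ := fun f hf hf₀ =>
    Multiset.disjoint_left.1 hdisj (Multiset.mem_map_of_mem u
      ((hmem f hf).1 (Multiset.mem_add.2 (.inr hf₀)))) hf₀
  refine ⟨Multiset.nodup_add.2 ⟨hM₀, hnd hA, Multiset.disjoint_right.2 ?_⟩, fun a => ?_⟩
  · intro a ha
    obtain ⟨f, hf, rfl⟩ := Multiset.mem_map.1 ha
    exact hout f (hA hf)
  · simp only [Multiset.mem_add, Multiset.mem_map, Finset.mem_val]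
    refine or_congr_left ⟨fun ha => ⟨.inr ha, ?_⟩, ?_⟩
    · rintro f hf rfl
      exact hout f (hP hf) ha
    · rintro ⟨⟨f, hf, rfl⟩ | ha, h'⟩
      · exact absurd rfl (h' f hf)
      · exact ha

namespace DBNet.Unfolding.Choice

variable {B : DBNet.{u}} {t : B.control.Trans} {x : B.Unfolding t} (d : x.Choice)

theorem rep_after {f : Fin x.n} (hf : f ∈ d.after) : d.rep f = f := by
  classical
  simp only [after, Finset.mem_union, Finset.mem_image, Finset.mem_sdiff] at hf
  rcases hf with ⟨g, -, rfl⟩ | ⟨hf, -⟩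
  · exact d.rep_rep g
  · exact d.rep_present f hf

open scoped Classical in
/-- If the choice describes the facts of the action correctly, then the exchange of present facts
for facts present after the update is the update. -/
theorem nodup_and_mem_updated {I : B.persistence.schema.Instance} {σ : B.domain.Binding}
    {θ : B.domain.Assignment B.domain.NVar}
    (hθ : ∀ f, x.varFact θ (d.rep f) = x.fact σ f)
    (hclash : ∀ f g, d.rep f ≠ d.rep g → x.fact σ f ≠ x.fact σ g)
    (hfound : ∀ f, d.rep f = f → (x.fact σ f ∈ I ↔ f ∈ d.present))
    (R : B.persistence.schema.Rel)
    {M M' : Multiset (B.domain.Tuple (B.persistence.schema.sig R))} (hM : M.Nodup)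
    (hMI : ∀ a, a ∈ M ↔ (⟨R, a⟩ : B.persistence.schema.Fact) ∈ I)
    (h : M' + ({f ∈ d.present | x.rel f = R} : Finset _).val.map
        (fun (f : Fin x.n) i => θ _ (factVar f i.1)) =
      M + ({f ∈ d.after | x.rel f = R} : Finset _).val.map (fun (f : Fin x.n) i => θ _ (factVar f i.1))) :
    M'.Nodup ∧ ∀ a, a ∈ M' ↔ (⟨R, a⟩ : B.persistence.schema.Fact) ∈ B.updated I t σ := by
  set u : Fin x.n → B.domain.Tuple (B.persistence.schema.sig R) :=
    fun f i => θ _ (factVar f i.1) with hu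
  have hval : ∀ f, d.rep f = f → x.rel f = R →
      x.fact σ f = (⟨R, u f⟩ : B.persistence.schema.Fact) := by
    rintro f hf rfl
    rw [← hθ, hf]
    rfl
  have hrep : ∀ f, x.fact σ (d.rep f) = x.fact σ f := fun f => by
    rw [← hθ, d.rep_rep, hθ]
  have hmk : ∀ {a b : B.domain.Tuple (B.persistence.schema.sig R)},
      (⟨R, a⟩ : B.persistence.schema.Fact) = ⟨R, b⟩ → a = b := fun h => by simpa using h
  have hrelof : ∀ {f a}, (⟨R, a⟩ : B.persistence.schema.Fact) = x.fact σ f → x.rel f = R :=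
    fun h => (congrArg Sigma.fst h).symm
  obtain ⟨h1, h2⟩ := Multiset.nodup_and_mem_of_replace
    (u := u) (P := {f ∈ d.present | x.rel f = R})
    (A := {f ∈ d.after | x.rel f = R})
    (reps := ({f | d.rep f = f ∧ x.rel f = R} : Finset (Fin x.n))) hM h
    (by
      intro f hf g hg hfg
      simp only [Finset.coe_filter, Finset.mem_univ, true_and, Set.mem_ofPred_eq] at hf hg
      by_contra hne
      refine hclash f g (by rwa [hf.1, hg.1]) ?_
      rw [hval f hf.1 hf.2, hval g hg.1 hg.2, hfg])
    (by
      intro f hf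
      simp only [Finset.mem_filter, Finset.mem_univ, true_and] at hf ⊢
      exact ⟨d.rep_present f hf.1, hf.2⟩)
    (by
      intro f hf
      simp only [Finset.mem_filter, Finset.mem_univ, true_and] at hf ⊢
      exact ⟨d.rep_after hf.1, hf.2⟩)
    (by
      intro f hf
      simp only [Finset.mem_filter, Finset.mem_univ, true_and] at hf ⊢
      rw [hMI, ← hval f hf.1 hf.2, hfound f hf.1]
      exact ⟨fun h => ⟨h, hf.2⟩, fun h => h.1⟩)
  refine ⟨h1, fun a => ?_⟩
  rw [h2, x.mem_updated, hMI]
  simp only [Finset.mem_filter]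
  constructor
  · rintro (⟨ha, hP⟩ | ⟨f, ⟨hf, hfR⟩, rfl⟩)
    · refine .inl ⟨ha, fun f hf he => ?_⟩
      have he' : (⟨R, a⟩ : B.persistence.schema.Fact) = x.fact σ (d.rep f) := he.trans (hrep f).symm
      have hR := hrelof he'
      refine hP (d.rep f) ⟨(hfound _ (d.rep_rep f)).1 (he' ▸ ha), hR⟩ (hmk ?_)
      rw [← hval _ (d.rep_rep f) hR, he']
    · have hff := d.rep_after hf
      rw [← hval f hff hfR]
      simp only [after, Finset.mem_union, Finset.mem_image, Finset.mem_sdiff] at hf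
      rcases hf with ⟨g, hg, rfl⟩ | ⟨hf, hdel⟩
      · exact .inr ⟨g, hg, hrep g⟩
      · refine .inl ⟨(hfound f hff).2 hf, fun g hg he => ?_⟩
        by_cases hgf : d.rep g = d.rep f
        · exact hdel ⟨g, hg, hgf.trans hff⟩
        · exact hclash g f hgf he.symm
  · rintro (⟨ha, hdel⟩ | ⟨f, hf, he⟩)
    · by_cases hP : ∃ f ∈ d.present, x.rel f = R ∧ u f = a
      · obtain ⟨f, hf, hfR, rfl⟩ := hP
        refine .inr ⟨f, ⟨?_, hfR⟩, rfl⟩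
        simp only [after, Finset.mem_union, Finset.mem_image, Finset.mem_sdiff]
        refine .inr ⟨hf, ?_⟩
        rintro ⟨g, hg, rfl⟩
        refine hdel g hg ?_
        rw [← hval _ (d.rep_rep g) hfR]
        exact hrep g
      · exact .inl ⟨ha, fun f hf hfa => hP ⟨f, hf.1, hf.2, hfa⟩⟩
    · have he' : (⟨R, a⟩ : B.persistence.schema.Fact) = x.fact σ (d.rep f) := he.trans (hrep f).symm
      have hR := hrelof he'
      refine .inr ⟨d.rep f, ⟨?_, hR⟩, hmk ?_⟩
      · simp only [after, Finset.mem_union, Finset.mem_image]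
        exact .inl ⟨f, hf, rfl⟩
      · rw [← hval _ (d.rep_rep f) hR, he']

end DBNet.Unfolding.Choice

/-! ### The bisimulation -/

namespace DBNet

variable {B : DBNet.{u}}

open scoped Classical in
theorem mem_single_iff {K : Type} {A : K → Type*} {y : Σ k, A k} {k : K} {a : A k} :
    a ∈ Pi.single (M := fun k => Multiset (A k)) y.1 {y.2} k ↔ (⟨k, a⟩ : Σ k, A k) = y := by
  obtain ⟨j, b⟩ := y
  by_cases h : k = j
  · subst h
    simp
  · rw [Pi.single_eq_of_ne h]
    exact ⟨fun h' => absurd h' (Multiset.notMem_zero a), fun h' => absurd (congrArg Sigma.fst h') h⟩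

section

variable {K : Type} {auxColor : K → B.domain.Color} {T : Type} [Finite T] [Finite K]
  {e : T → EncTrans B auxColor}

theorem EncTrans.mem_flowVars_iff {t : T} {v : Σ τ, XVar B.domain τ} :
    v ∈ NuCPN.flowVars (EncTrans.net e).outFlow t ↔
      (∃ p, ∃ w ∈ (e t).ctrlOut p, v ∈ B.domain.outVars w) ∨
      (∃ R, ∃ w ∈ (e t).relOut R, v ∈ B.domain.outVars w) ∨
      v ∈ B.domain.outVars (e t).dstInsc := by
  classical
  constructor
  · rintro ⟨p | R | k, w, hw, hv⟩
    · exact .inl ⟨p, w, hw, hv⟩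
    · exact .inr (.inl ⟨R, w, hw, hv⟩)
    · refine .inr (.inr ?_)
      have := (mem_single_iff (A := fun k => B.domain.OutInsc (auxColor k))
        (y := ⟨(e t).dst, (e t).dstInsc⟩)).1 hw
      cases this
      exact hv
  · rintro (⟨p, w, hw, hv⟩ | ⟨R, w, hw, hv⟩ | hv)
    · exact ⟨.inl p, w, hw, hv⟩
    · exact ⟨.inr (.inl R), w, hw, hv⟩
    · refine ⟨.inr (.inr (e t).dst), (e t).dstInsc, ?_, hv⟩
      exact (mem_single_iff (A := fun k => B.domain.OutInsc (auxColor k))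
        (y := ⟨(e t).dst, (e t).dstInsc⟩)).2 rfl

end

/-- The values of a snapshot, from which fresh values have to differ. -/
def Snapshot.used (s : B.Snapshot) (τ : B.domain.Ty) : Set (B.domain.Dom τ) :=
  B.persistence.schema.adom s.inst τ ∪ s.mark.adom τ

/-- A value that does not occur in the encoding does not occur in the snapshot. -/
theorem FlatEq.used_subset {K : Type} {auxColor : K → B.domain.Color} {s : B.Snapshot}
    {M : Marking B.domain (B.encColor auxColor)} (h : B.FlatEq s M) (τ : B.domain.Ty) :
    s.used τ ⊆ M.adom τ := by
  rintro o (⟨⟨R, a⟩, hf, ho⟩ | ⟨p, a, ha, ho⟩)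
  · exact ⟨.inr (.inl R), a, ((h.2 R).2 a).2 hf, ho⟩
  · exact ⟨.inl p, a, (h.1 p).symm ▸ ha, ho⟩

variable {X : ∀ t, B.Unfolding t}

/-- The auxiliary token that marks that nothing is guessed. -/
def idle : Σ k, B.domain.Tuple (tokenColor X k) := ⟨none, fun i => i.elim0⟩

/-- The auxiliary token that stores a guess. -/
noncomputable def guessed (κ : Key X) (σ : B.domain.Binding) :
    Σ k, B.domain.Tuple (tokenColor X k) := ⟨some κ, κ.2.tok σ⟩

theorem eq_idle {y : Σ k, B.domain.Tuple (tokenColor X k)} (h : y.1 = none) : y = idle := by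
  obtain ⟨k, a⟩ := y
  obtain rfl : k = none := h
  simp only [idle]
  congr 1
  funext i
  exact i.elim0

theorem mk_eq_guessed_iff {κ κ' : Key X} {σ : B.domain.Binding}
    {a : B.domain.Tuple (tokenColor X (some κ))} :
    (⟨some κ, a⟩ : Σ k, B.domain.Tuple (tokenColor X k)) = guessed κ' σ ↔
      κ = κ' ∧ a = κ.2.tok σ := by
  constructor
  · intro h
    obtain rfl : κ = κ' := Option.some.inj (congrArg Sigma.fst h)
    exact ⟨rfl, eq_of_heq (Sigma.mk.inj h).2⟩
  · rintro ⟨rfl, rfl⟩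
    rfl

/-- The auxiliary token without components adds no values, so that freshness means the same in the
snapshot and in a state without a guess. -/
theorem FlatEq.adom_subset_used {s : B.Snapshot}
    {M : Marking B.domain (B.encColor (tokenColor X))} (h : B.FlatEq s M) (hM : AuxAt M idle)
    (τ : B.domain.Ty) : M.adom τ ⊆ s.used τ := by
  classical
  rintro o ⟨p | R | k, a, ha, ho⟩
  · exact .inr ⟨p, a, h.1 p ▸ ha, ho⟩
  · exact .inl ⟨⟨R, a⟩, ((h.2 R).2 a).1 ha, ho⟩
  · have ha' : a ∈ auxPart M k := ha
    rw [hM k] at ha'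
    obtain rfl : k = none := congrArg Sigma.fst
      ((mem_single_iff (A := fun k => B.domain.Tuple (tokenColor X k))).1 ha')
    obtain ⟨i, -⟩ := ho
    exact i.elim0

/-- The states of the encoding that correspond to a snapshot: nothing is guessed, or a binding is
guessed whose fresh values are indeed fresh. -/
def Encodes (s : B.Snapshot) (M : Marking B.domain (B.encColor (tokenColor X))) : Prop :=
  B.FlatEq s M ∧ (AuxAt M idle ∨
    ∃ κ σ, AuxAt M (guessed κ σ) ∧ σ.FreshFor (B.outVars κ.1) s.used)

theorem Encodes.exists_auxAt {s : B.Snapshot} {M : Marking B.domain (B.encColor (tokenColor X))}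
    (h : Encodes s M) : ∃ y, AuxAt M y := by
  rcases h.2 with h | ⟨κ, σ, h, -⟩
  · exact ⟨_, h⟩
  · exact ⟨_, h⟩

theorem auxTrans_moves_iff {κ : Key X} {a : κ.2.AuxOp} {σ : B.domain.Binding}
    {M M' : Marking B.domain (B.encColor (tokenColor X))} {y} (hM : AuxAt M y)
    (hy : (⟨(auxTrans κ a).src, σ.inTuple (auxTrans κ a).srcInsc⟩ :
      Σ k, B.domain.Tuple (tokenColor X k)) = y) :
    (encNet X).Moves (encNet X).outFlow M (.inr ⟨κ, a⟩) σ M' ↔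
      (∀ p, ctrlPart M' p = ctrlPart M p) ∧ (∀ R, relPart M' R = relPart M R) ∧
      AuxAt M' ⟨(auxTrans κ a).dst, σ.outTuple (auxTrans κ a).dstInsc⟩ := by
  have := EncTrans.moves_iff (e := encTrans X) (t := .inr ⟨κ, a⟩) (M' := M') hM hy
  refine this.trans ?_
  have e1 : ∀ p, (encTrans X (.inr ⟨κ, a⟩)).ctrlIn p = 0 := by cases a <;> exact fun _ => rfl
  have e2 : ∀ p, (encTrans X (.inr ⟨κ, a⟩)).ctrlOut p = 0 := by cases a <;> exact fun _ => rfl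
  have e3 : ∀ p, (encTrans X (.inr ⟨κ, a⟩)).relIn p = 0 := by cases a <;> exact fun _ => rfl
  have e4 : ∀ p, (encTrans X (.inr ⟨κ, a⟩)).relOut p = 0 := by cases a <;> exact fun _ => rfl
  simp only [e1, e2, e3, e4, Multiset.map_zero, add_zero]
  rfl

theorem auxTrans_ready_iff {κ : Key X} {a : κ.2.AuxOp} {σ : B.domain.Binding}
    {M : Marking B.domain (B.encColor (tokenColor X))} {y} (hM : AuxAt M y) :
    (encNet X).Ready M (.inr ⟨κ, a⟩) σ ↔
      (⟨(auxTrans κ a).src, σ.inTuple (auxTrans κ a).srcInsc⟩ :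
        Σ k, B.domain.Tuple (tokenColor X k)) = y ∧
      ∀ R, ∀ w ∈ (auxTrans κ a).relRead R, σ.inTuple w ∈ relPart M R := by
  refine (EncTrans.ready_iff (e := encTrans X) (t := .inr ⟨κ, a⟩) hM).trans ?_
  have e1 : ∀ p, (encTrans X (.inr ⟨κ, a⟩)).ctrlIn p = 0 := by cases a <;> exact fun _ => rfl
  have e2 : ∀ p, (encTrans X (.inr ⟨κ, a⟩)).ctrlRead p = 0 := by cases a <;> exact fun _ => rfl
  have e3 : ∀ p, (encTrans X (.inr ⟨κ, a⟩)).relIn p = 0 := by cases a <;> exact fun _ => rfl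
  have e4 : (encTrans X (.inr ⟨κ, a⟩)).guard = .tru := by cases a <;> rfl
  simp only [e1, e2, e3, e4, Multiset.map_zero, zero_le, Multiset.notMem_zero, Guard.Holds,
    false_imp_iff, implies_true, and_true, true_and]
  rfl

theorem FlatEq.of_parts_eq {K : Type} {auxColor : K → B.domain.Color} {s : B.Snapshot}
    {M M' : Marking B.domain (B.encColor auxColor)} (h : B.FlatEq s M)
    (h1 : ∀ p, ctrlPart M' p = ctrlPart M p) (h2 : ∀ R, relPart M' R = relPart M R) :
    B.FlatEq s M' :=
  ⟨fun p => (h1 p).trans (h.1 p), fun R => by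
    have := h.2 R
    rw [show M (.inr (.inl R)) = M' (.inr (.inl R)) from (h2 R).symm] at this
    exact this⟩

theorem mk_rename_ne_fresh {𝔇 : TypeDomain.{u}} {τ τ' : 𝔇.Ty} (z : Term 𝔇 𝔇.XVar τ) {n : ℕ} {hn} :
    (⟨τ, z.rename fun _ v => .normal v.code⟩ : Σ τ, Term 𝔇 𝔇.XVar τ) ≠
      ⟨τ', .var (.fresh n hn)⟩ := by
  intro h
  obtain rfl : τ = τ' := congrArg Sigma.fst h
  cases z <;> simp [Term.rename] at h

theorem fresh_notMem_flowVars {T : Key X ⊕ (Σ κ : Key X, κ.2.AuxOp)}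
    (hT : (encTrans X T).dst = none) (τ : B.domain.Ty) (n : ℕ) (hn) :
    (⟨τ, .fresh n hn⟩ : Σ τ, XVar B.domain τ) ∉ NuCPN.flowVars (encNet X).outFlow T := by
  intro h
  rcases EncTrans.mem_flowVars_iff.1 h with ⟨p, w, hw, i, hi⟩ | ⟨R, w, hw, i, hi⟩ | ⟨i, -⟩
  · rcases T with κ | ⟨κ, a⟩
    · obtain ⟨w, -, rfl⟩ := Multiset.mem_map.1 hw
      exact mk_rename_ne_fresh _ hi
    · have e : (encTrans X (.inr ⟨κ, a⟩)).ctrlOut p = 0 := by cases a <;> rfl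
      rw [e] at hw
      exact absurd hw (Multiset.notMem_zero w)
  · rcases T with κ | ⟨κ, a⟩
    · obtain ⟨f, -, rfl⟩ := Multiset.mem_map.1 hw
      simp only at hi
      have := congrArg Sigma.fst hi
      simp only at this
      subst this
      simp at hi
    · have e : (encTrans X (.inr ⟨κ, a⟩)).relOut R = 0 := by cases a <;> rfl
      rw [e] at hw
      exact absurd hw (Multiset.notMem_zero w)
  · revert i
    rw [hT]
    exact fun i => i.elim0

theorem enabled_of_ready {T : Key X ⊕ (Σ κ : Key X, κ.2.AuxOp)} {σ : B.domain.Binding}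
    {M : Marking B.domain (B.encColor (tokenColor X))} (hT : (encTrans X T).dst = none)
    (h : (encNet X).Ready M T σ) : (encNet X).Enabled M T σ :=
  ⟨h, σ.freshFor_of_forall_not_fresh _ (fresh_notMem_flowVars hT)⟩

theorem flowVars_guess (κ : Key X) :
    NuCPN.flowVars (encNet X).outFlow (.inr ⟨κ, .guess⟩) =
      B.domain.outVars (packOut κ.2.slotTy κ.2.slotTerm) := by
  ext v
  refine EncTrans.mem_flowVars_iff.trans ⟨?_, fun h => .inr (.inr h)⟩
  rintro (⟨p, w, hw, -⟩ | ⟨R, w, hw, -⟩ | h)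
  · exact absurd hw (Multiset.notMem_zero w)
  · exact absurd hw (Multiset.notMem_zero w)
  · exact h

theorem outVars_subset_flowVars_guess (κ : Key X) :
    B.outVars κ.1 ⊆ NuCPN.flowVars (encNet X).outFlow (.inr ⟨κ, .guess⟩) := fun v hv => by
  rw [flowVars_guess]
  exact mem_outVars_packOut.2 ⟨.inl ⟨v, hv⟩, rfl⟩

/-- The other variables that a guess outputs, those of the pins, are normal. -/
theorem fresh_mem_outVars_of_mem_flowVars_guess (κ : Key X) {τ : B.domain.Ty} {n : ℕ} {hn}
    (h : (⟨τ, .fresh n hn⟩ : Σ τ, XVar B.domain τ) ∈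
      NuCPN.flowVars (encNet X).outFlow (.inr ⟨κ, .guess⟩)) :
    (⟨τ, .fresh n hn⟩ : Σ τ, XVar B.domain τ) ∈ B.outVars κ.1 := by
  rw [flowVars_guess] at h
  obtain ⟨v | ⟨f, i⟩ | ⟨j, b⟩, hs⟩ := mem_outVars_packOut.1 h
  · obtain ⟨⟨τ', v⟩, hv⟩ := v
    simp only [Unfolding.Choice.slotTy, Unfolding.Choice.slotTerm] at hs
    cases hs
    exact hv
  · exact (X κ.1).args_vars f ⟨i, hs⟩
  · simp only [Unfolding.Choice.slotTy, Unfolding.Choice.slotTerm] at hs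
    generalize κ.2.reader.pins.get j = y at hs
    obtain ⟨τ', m, z⟩ := y
    have := congrArg Sigma.fst hs
    simp only at this
    subst this
    cases z <;> simp [Term.rename] at hs

theorem freshFor_flowVars_guess {κ : Key X} {σ : B.domain.Binding}
    {used : (τ : B.domain.Ty) → Set (B.domain.Dom τ)} (h : σ.FreshFor (B.outVars κ.1) used) :
    σ.FreshFor (NuCPN.flowVars (encNet X).outFlow (.inr ⟨κ, .guess⟩)) used :=
  ⟨fun τ n hn hv => h.1 τ n hn (fresh_mem_outVars_of_mem_flowVars_guess κ hv),
    fun τ n n' hn hn' hv hv' => h.2 τ n n' hn hn' (fresh_mem_outVars_of_mem_flowVars_guess κ hv)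
      (fresh_mem_outVars_of_mem_flowVars_guess κ hv')⟩

/-- The guess of `κ` and `σ` is refuted by the database `I`. -/
def Refuted (I : B.persistence.schema.Instance) (κ : Key X) (σ : B.domain.Binding) : Prop :=
  (∃ f g, κ.2.rep f ≠ κ.2.rep g ∧ (X κ.1).fact σ f = (X κ.1).fact σ g) ∨
    ∃ f, κ.2.rep f = f ∧ f ∉ κ.2.present ∧ (X κ.1).fact σ f ∈ I

/-- The transitions of positive priority detect that a guess is refuted. -/
theorem refuted_of_enabled {s : B.Snapshot} {M : Marking B.domain (B.encColor (tokenColor X))}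
    (hs : B.FlatEq s M) {T σ y} (hM : AuxAt M y) (hE : (encNet X).Ready M T σ)
    (hp : 0 < (encNet X).prio T) :
    (∃ κ a, T = .inr ⟨κ, a⟩ ∧ (auxTrans κ a).dst = none ∧ (encNet X).prio T = 1) ∧
      ∀ κ σ₀, y = guessed κ σ₀ → Refuted s.inst κ σ₀ := by
  rcases T with κ | ⟨κ, a⟩
  · exact absurd hp (lt_irrefl 0)
  · have hr := (auxTrans_ready_iff hM).1 hE
    cases a with
    | guess => exact absurd hp (lt_irrefl 0)
    | undo => exact absurd hp (lt_irrefl 0)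
    | clash f g hrel hrep =>
      refine ⟨⟨κ, _, rfl, rfl, rfl⟩, ?_⟩
      rintro κ' σ₀ rfl
      obtain ⟨rfl, ht⟩ := mk_eq_guessed_iff.1 hr.1
      refine .inl ⟨f, g, hrep, ?_⟩
      have ht' : σ.inTuple (packIn _ (κ.2.testVar fun h => if h = g.1 then f.1 else h)) =
        κ.2.tok σ₀ := ht
      rw [← κ.2.fact_eq_of_inTuple_testVar ht' (f := f) (g := f) (by simp) rfl,
        κ.2.fact_eq_of_inTuple_testVar ht' (f := g) (g := f) (by simp) hrel]
    | found f hrep hf =>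
      refine ⟨⟨κ, _, rfl, rfl, rfl⟩, ?_⟩
      rintro κ' σ₀ rfl
      obtain ⟨rfl, ht⟩ := mk_eq_guessed_iff.1 hr.1
      refine .inr ⟨f, hrep, hf, ?_⟩
      have ht' : σ.inTuple (packIn _ (κ.2.testVar id)) = κ.2.tok σ₀ := ht
      rw [← κ.2.fact_eq_of_inTuple_testVar ht' (f := f) (g := f) rfl rfl]
      refine ((hs.2 _).2 _).1 (hr.2 ((X κ.1).rel f)
        (fun i => Unfolding.Choice.factVar f i.1) ?_)
      simp only [auxTrans, silentTrans, if_true]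
      exact Multiset.mem_singleton_self _

/-- If a guess is refuted, then a transition of positive priority is enabled. -/
theorem Refuted.exists_enabled {s : B.Snapshot}
    {M : Marking B.domain (B.encColor (tokenColor X))} (hs : B.FlatEq s M) {κ : Key X}
    {σ : B.domain.Binding} (hM : AuxAt M (guessed κ σ)) (h : Refuted s.inst κ σ) :
    ∃ T σ', (encNet X).Enabled M T σ' ∧ (encNet X).prio T = 1 := by
  classical
  rcases h with ⟨f, g, hrep, hfg⟩ | ⟨f, hrep, hf, hI⟩
  · obtain ⟨σ', h1, -⟩ := κ.2.exists_inTuple_testVar σ (fun h => if h = g.1 then f.1 else h)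
      (fun h => by
        by_cases hh : h = g
        · exact ⟨f, by simp [hh], by rw [hh, hfg]⟩
        · exact ⟨h, by simp [Fin.val_inj, hh], rfl⟩)
    refine ⟨.inr ⟨κ, .clash f g (congrArg Sigma.fst hfg) hrep⟩, σ', enabled_of_ready rfl
      ((auxTrans_ready_iff hM).2 ⟨mk_eq_guessed_iff.2 ⟨rfl, h1⟩, ?_⟩), rfl⟩
    exact fun R w hw => absurd hw (Multiset.notMem_zero w)
  · obtain ⟨σ', h1, h2⟩ := κ.2.exists_inTuple_testVar σ id fun h => ⟨h, rfl, rfl⟩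
    refine ⟨.inr ⟨κ, .found f hrep hf⟩, σ', enabled_of_ready rfl
      ((auxTrans_ready_iff hM).2 ⟨mk_eq_guessed_iff.2 ⟨rfl, h1⟩, ?_⟩), rfl⟩
    intro R w hw
    simp only [auxTrans, silentTrans] at hw
    split_ifs at hw with hR
    · subst hR
      rw [Multiset.mem_singleton] at hw
      subst hw
      rw [← h2 f] at hI
      exact ((hs.2 _).2 _).2 hI
    · exact absurd hw (Multiset.notMem_zero w)

theorem prio_le_zero_of_not_refuted {s : B.Snapshot}
    {M : Marking B.domain (B.encColor (tokenColor X))} (hs : B.FlatEq s M) {κ : Key X}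
    {σ : B.domain.Binding} (hM : AuxAt M (guessed κ σ)) (h : ¬ Refuted s.inst κ σ) (T σ')
    (hT : (encNet X).Enabled M T σ') : (encNet X).prio T ≤ 0 := by
  by_contra hp
  exact h ((refuted_of_enabled hs hM hT.1 (by omega)).2 κ σ rfl)

theorem not_refuted_of_prio {s : B.Snapshot}
    {M : Marking B.domain (B.encColor (tokenColor X))} (hs : B.FlatEq s M) {κ : Key X}
    {σ : B.domain.Binding} (hM : AuxAt M (guessed κ σ))
    (h : ∀ T σ', (encNet X).Enabled M T σ' → (encNet X).prio T ≤ 0) : ¬ Refuted s.inst κ σ := by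
  intro hr
  obtain ⟨T, σ', hT, hp⟩ := hr.exists_enabled hs hM
  have := h T σ' hT
  omega

/-- A silent step, if enabled with maximal priority, leads to a marking that encodes the same
snapshot. -/
theorem exists_silent_step {s : B.Snapshot} {M : Marking B.domain (B.encColor (tokenColor X))}
    (hs : B.FlatEq s M) {y} (hM : AuxAt M y) {κ : Key X} {a : κ.2.AuxOp} {σ : B.domain.Binding}
    (hE : (encNet X).Enabled M (.inr ⟨κ, a⟩) σ)
    (hp : ∀ T σ', (encNet X).Enabled M T σ' → (encNet X).prio T ≤ (encNet X).prio (.inr ⟨κ, a⟩))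
    {L : Type} (lab : Key X → L) (M₀) :
    ∃ M', ((encNet X).lts (Sum.elim (fun t => some (lab t)) fun _ => none) M₀).step M none M' ∧
      B.FlatEq s M' ∧ AuxAt M' ⟨(auxTrans κ a).dst, σ.outTuple (auxTrans κ a).dstInsc⟩ := by
  obtain ⟨M', hM'⟩ := hE.1.exists_moves
  have := (auxTrans_moves_iff hM ((auxTrans_ready_iff hM).1 hE.1).1).1 hM'
  exact ⟨M', ⟨_, σ, rfl, hE, hp, hM'⟩, hs.of_parts_eq this.1 this.2.1, this.2.2⟩

/-- From every state that encodes a snapshot, silent steps lead to a state without a guess: a refuted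
guess is withdrawn by a transition of positive priority, and any other guess by `undo`. -/
theorem Encodes.exists_silent_idle {s : B.Snapshot}
    {M : Marking B.domain (B.encColor (tokenColor X))} (h : Encodes s M) {L : Type}
    (lab : Key X → L) (M₀) :
    ∃ M', ((encNet X).lts (Sum.elim (fun t => some (lab t)) fun _ => none) M₀).Silent M M' ∧
      B.FlatEq s M' ∧ AuxAt M' idle := by
  obtain ⟨hs, hM | ⟨κ, σ, hM, -⟩⟩ := h
  · exact ⟨M, .refl, hs, hM⟩
  · have key : ∃ κ' a σ', (auxTrans κ' a).dst = none ∧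
        (encNet X).Enabled M (.inr ⟨κ', a⟩) σ' ∧ ∀ T σ'', (encNet X).Enabled M T σ'' →
          (encNet X).prio T ≤ (encNet X).prio (.inr ⟨κ', a⟩) := by
      by_cases hr : Refuted s.inst κ σ
      · obtain ⟨T, σ', hT, hp⟩ := hr.exists_enabled hs hM
        obtain ⟨κ', a, rfl, hd, hp1⟩ := (refuted_of_enabled hs hM hT.1 (by omega)).1
        refine ⟨κ', a, σ', hd, hT, fun T' σ'' hT' => ?_⟩
        by_cases hp' : 0 < (encNet X).prio T'
        · obtain ⟨_, _, _, _, hp2⟩ := (refuted_of_enabled hs hM hT'.1 hp').1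
          omega
        · omega
      · obtain ⟨σ', h1, -⟩ := κ.2.exists_inTuple_testVar σ id fun h => ⟨h, rfl, rfl⟩
        refine ⟨κ, .undo, σ', rfl, enabled_of_ready rfl ((auxTrans_ready_iff hM).2
          ⟨mk_eq_guessed_iff.2 ⟨rfl, h1⟩, fun R w hw => absurd hw (Multiset.notMem_zero w)⟩),
          prio_le_zero_of_not_refuted hs hM hr⟩
    obtain ⟨κ', a, σ', hd, hE, hp⟩ := key
    obtain ⟨M', hstep, hs', hM'⟩ := exists_silent_step hs hM hE hp lab M₀
    refine ⟨M', .single hstep, hs', ?_⟩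
    exact eq_idle (y := ⟨(auxTrans κ' a).dst, σ'.outTuple (auxTrans κ' a).dstInsc⟩) hd ▸ hM'

open Unfolding.Choice (factVar)

open scoped Classical in
theorem fireTrans_ready_iff {s : B.Snapshot} {M : Marking B.domain (B.encColor (tokenColor X))}
    (hs : B.FlatEq s M) {κ : Key X} {σ₀ σ₁ : B.domain.Binding} (hM : AuxAt M (guessed κ σ₀)) :
    (encNet X).Ready M (.inl κ) σ₁ ↔
      σ₁.inTuple (packIn κ.2.slotTy κ.2.fireVar) = κ.2.tok σ₀ ∧
      B.control.net.Ready s.mark κ.1 (decode σ₁.onNormal) ∧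
      (∀ R, ({f ∈ κ.2.present | (X κ.1).rel f = R} : Finset _).val.map
        (fun (f : Fin (X κ.1).n) i => σ₁.onNormal _ (factVar f i.1)) ≤ relPart M R) ∧
      (∀ y ∈ κ.2.reader.reads, (⟨y.1, fun i => σ₁.onNormal _ (y.2 i.1)⟩ :
        B.persistence.schema.Fact) ∈ s.inst) ∧
      κ.2.reader.guard.Holds σ₁.onNormal := by
  have hctrl : ∀ p, ctrlPart M p = s.mark p := hs.1
  refine (EncTrans.ready_iff (e := encTrans X) (t := .inl κ) hM).trans ?_
  have h1 : (⟨some κ, σ₁.inTuple (packIn κ.2.slotTy κ.2.fireVar)⟩ :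
      Σ k, B.domain.Tuple (tokenColor X k)) = guessed κ σ₀ ↔
      σ₁.inTuple (packIn κ.2.slotTy κ.2.fireVar) = κ.2.tok σ₀ :=
    mk_eq_guessed_iff.trans (and_iff_right rfl)
  have h2 : ∀ p, ((encTrans X (.inl κ)).ctrlIn p).map σ₁.inTuple =
      (B.control.net.inFlow p κ.1).map (decode σ₁.onNormal).inTuple := fun p =>
    Multiset.map_map _ _ _
  have h3 : ∀ p, (∀ w ∈ (encTrans X (.inl κ)).ctrlRead p, σ₁.inTuple w ∈ s.mark p) ↔
      ∀ w ∈ B.control.net.readFlow p κ.1, (decode σ₁.onNormal).inTuple w ∈ s.mark p := fun p =>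
    Multiset.forall_mem_map_iff
  have h4 : ∀ R, ((encTrans X (.inl κ)).relIn R).map σ₁.inTuple =
      ({f ∈ κ.2.present | (X κ.1).rel f = R} : Finset _).val.map
        (fun (f : Fin (X κ.1).n) i => σ₁.onNormal _ (factVar f i.1)) := fun R =>
    Multiset.map_map _ _ _
  have h5 : (∀ R, ∀ w ∈ (encTrans X (.inl κ)).relRead R, σ₁.inTuple w ∈ relPart M R) ↔
      ∀ y ∈ κ.2.reader.reads, (⟨y.1, fun i => σ₁.onNormal _ (y.2 i.1)⟩ :
        B.persistence.schema.Fact) ∈ s.inst := by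
    have : ∀ R, (∀ w ∈ (encTrans X (.inl κ)).relRead R, σ₁.inTuple w ∈ relPart M R) ↔
        ∀ y ∈ κ.2.reader.reads, y.1 = R →
          (fun i => σ₁.onNormal _ (y.2 i.1)) ∈ relPart M R := fun R => by
      constructor
      · intro h y hy e
        exact h _ (Multiset.mem_map_of_mem _
          (Multiset.mem_coe.2 (List.mem_filter.2 ⟨hy, decide_eq_true e⟩)))
      · intro h w hw
        change w ∈ (fireTrans κ).relRead R at hw
        simp only [fireTrans, Multiset.mem_map] at hw
        obtain ⟨y, hy, rfl⟩ := hw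
        have hy' := List.mem_filter.1 (Multiset.mem_coe.1 hy)
        exact h y hy'.1 (of_decide_eq_true hy'.2)
    simp only [this]
    constructor
    · intro h y hy
      exact ((hs.2 _).2 _).1 (h _ y hy rfl)
    · rintro h _ y hy rfl
      exact ((hs.2 _).2 _).2 (h y hy)
  have h6 : (encTrans X (.inl κ)).guard.Holds σ₁.onNormal ↔
      (B.control.net.guard κ.1).Holds (decode σ₁.onNormal).onNormal ∧
        κ.2.reader.guard.Holds σ₁.onNormal :=
    and_congr_left fun _ => Guard.holds_rename _ _ _
  simp only [h2, h4, hctrl, h3]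
  rw [h5, h6]
  refine (and_congr_left fun _ => h1).trans ?_
  simp only [NuCPN.Ready]
  tauto

/-- If a guess is not refuted, then firing its transition has the effect of the transition of the
DB-net. -/
theorem fireTrans_moves {s : B.Snapshot} {M M' : Marking B.domain (B.encColor (tokenColor X))}
    (hs : B.FlatEq s M) {κ : Key X} {σ₀ σ₁ : B.domain.Binding} (hM : AuxAt M (guessed κ σ₀))
    (hr : ¬ Refuted s.inst κ σ₀) (hE : (encNet X).Ready M (.inl κ) σ₁)
    (hM' : (encNet X).Moves (encNet X).outFlow M (.inl κ) σ₁ M') :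
    B.control.net.Moves B.control.net.outFlow s.mark κ.1 (decode σ₁.onNormal) (ctrlPart M') ∧
    (∀ R, (relPart M' R).Nodup ∧ ∀ a, a ∈ relPart M' R ↔
      (⟨R, a⟩ : B.persistence.schema.Fact) ∈ B.updated s.inst κ.1 (decode σ₁.onNormal)) ∧
    AuxAt M' idle := by
  classical
  obtain ⟨htok, -, hin, -⟩ := (fireTrans_ready_iff hs hM).1 hE
  obtain ⟨h1, h2, h3⟩ := (EncTrans.moves_iff (e := encTrans X) (t := .inl κ) hM
    (mk_eq_guessed_iff.2 ⟨rfl, htok⟩)).1 hM'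
  have hfact : ∀ f, (X κ.1).fact (decode σ₁.onNormal) f = (X κ.1).fact σ₀ f :=
    (X κ.1).fact_congr (κ.2.decode_eq_of_inTuple_fireVar htok)
  have hvar := (κ.2.inTuple_fireVar_eq_tok_iff.1
    (htok.trans (κ.2.tok_eq_of_inTuple_fireVar htok).symm)).1
  simp only [Refuted, not_or, not_exists, not_and] at hr
  refine ⟨fun p => ?_, fun R => ?_, eq_idle (y := ⟨(encTrans X (.inl κ)).dst,
    σ₁.outTuple (encTrans X (.inl κ)).dstInsc⟩) rfl ▸ h3⟩
  · have e1 : ((encTrans X (.inl κ)).ctrlIn p).map σ₁.inTuple =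
        (B.control.net.inFlow p κ.1).map (decode σ₁.onNormal).inTuple := Multiset.map_map _ _ _
    have e2 : ((encTrans X (.inl κ)).ctrlOut p).map σ₁.outTuple =
        (B.control.net.outFlow κ.1 p).map (decode σ₁.onNormal).outTuple :=
      (Multiset.map_map _ _ _).trans (Multiset.map_congr rfl fun w _ =>
        funext fun i => Term.eval_rename _ _ _)
    have := h1 p
    rw [e1, e2, show ctrlPart M p = s.mark p from hs.1 p] at this
    exact this
  · refine κ.2.nodup_and_mem_updated (θ := σ₁.onNormal) (M := relPart M R) hvar ?_ ?_ R
      (hs.2 R).1 (hs.2 R).2 ?_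
    · intro f g hfg
      rw [hfact, hfact]
      exact hr.1 f g hfg
    · intro f hf
      refine ⟨fun hI => ?_, fun hp => ?_⟩
      · rw [hfact] at hI
        by_contra hp
        exact hr.2 f hf hp hI
      · rw [← hvar, hf]
        exact ((hs.2 _).2 _).1 (Multiset.subset_of_le (hin ((X κ.1).rel f))
          (Multiset.mem_map_of_mem _ (Finset.mem_filter.2 ⟨hp, rfl⟩)))
    · have e1 : ((encTrans X (.inl κ)).relIn R).map σ₁.inTuple =
          ({f ∈ κ.2.present | (X κ.1).rel f = R} : Finset _).val.map
            (fun (f : Fin (X κ.1).n) i => σ₁.onNormal _ (factVar f i.1)) :=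
        Multiset.map_map _ _ _
      have e2 : ((encTrans X (.inl κ)).relOut R).map σ₁.outTuple =
          ({f ∈ κ.2.after | (X κ.1).rel f = R} : Finset _).val.map
            (fun (f : Fin (X κ.1).n) i => σ₁.onNormal _ (factVar f i.1)) :=
        Multiset.map_map _ _ _
      have := h2 R
      rw [e1, e2] at this
      exact this

theorem complies_of_constraints_eq_empty (hC : B.persistence.constraints = ∅)
    (I : B.persistence.schema.Instance) : B.persistence.Complies I := by
  intro Φ hΦ
  rw [hC] at hΦ
  exact hΦ.elim

/-- A guess that is not refuted and whose transition is enabled is a guess of a step of the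
DB-net. -/
theorem exists_fires_of_fireTrans (hC : B.persistence.constraints = ∅) {s : B.Snapshot}
    {M M' : Marking B.domain (B.encColor (tokenColor X))} (hs : B.FlatEq s M) {κ : Key X}
    {σ₀ σ₁ : B.domain.Binding} (hM : AuxAt M (guessed κ σ₀))
    (hfresh : σ₀.FreshFor (B.outVars κ.1) s.used) (hr : ¬ Refuted s.inst κ σ₀)
    (hE : (encNet X).Ready M (.inl κ) σ₁)
    (hM' : (encNet X).Moves (encNet X).outFlow M (.inl κ) σ₁ M') :
    ∃ s', B.Fires s κ.1 (decode σ₁.onNormal) s' ∧ Encodes s' M' := by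
  obtain ⟨h1, h2, h3⟩ := fireTrans_moves hs hM hr hE hM'
  obtain ⟨htok, hready, -, hreads, hguard⟩ := (fireTrans_ready_iff hs hM).1 hE
  have hpins := (κ.2.inTuple_fireVar_eq_tok_iff.1
    (htok.trans (κ.2.tok_eq_of_inTuple_fireVar htok).symm)).2
  have hcomp := complies_of_constraints_eq_empty hC (B.updated s.inst κ.1 (decode σ₁.onNormal))
  refine ⟨⟨_, hcomp, ctrlPart M'⟩, ⟨⟨hready, ?_, ?_⟩, .inl ⟨hcomp, rfl, h1⟩⟩,
    ⟨fun _ => rfl, h2⟩, .inl h3⟩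
  · exact ((X κ.1).views _ _).2 ⟨_, .refl _ _, _, List.get_mem _ _, hreads, hguard, hpins⟩
  · exact hfresh.congr (κ.2.decode_eq_of_inTuple_fireVar htok)

/-- Some choice describes the facts of an action correctly. -/
theorem exists_choice {t : B.control.Trans} (x : B.Unfolding t)
    (I : B.persistence.schema.Instance) (σ : B.domain.Binding) (alt : Fin x.readers.length) :
    ∃ d : x.Choice, d.alt = alt ∧ (∀ f, x.fact σ (d.rep f) = x.fact σ f) ∧
      (∀ f g, x.fact σ f = x.fact σ g → d.rep f = d.rep g) ∧
      ∀ f, f ∈ d.present ↔ d.rep f = f ∧ x.fact σ f ∈ I := by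
  classical
  let S : Setoid (Fin x.n) := Setoid.ker (x.fact σ)
  have h1 : ∀ f, x.fact σ (Quotient.out (s := S) ⟦f⟧) = x.fact σ f := fun f =>
    Quotient.mk_out (s := S) f
  have h2 : ∀ f g, x.fact σ f = x.fact σ g →
      Quotient.out (s := S) ⟦f⟧ = Quotient.out (s := S) ⟦g⟧ := fun f g h =>
    congrArg Quotient.out (Quotient.sound (s := S) h)
  exact ⟨⟨fun f => Quotient.out (s := S) ⟦f⟧, fun f => h2 _ _ (h1 f),
    fun f => congrArg Sigma.fst (h1 f),
    {f | Quotient.out (s := S) ⟦f⟧ = f ∧ x.fact σ f ∈ I},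
    fun f hf => (Finset.mem_filter.1 hf).2.1, alt⟩, rfl, h1, h2, fun f => by simp⟩

/-- Every enabled transition of the DB-net has a guess that is not refuted and whose transition is
enabled. -/
theorem exists_fireTrans_of_enabled {s : B.Snapshot} {t : B.control.Trans}
    {σ : B.domain.Binding} (h : B.Enabled s t σ) :
    ∃ (κ : Key X) (σ₁ : B.domain.Binding), κ.1 = t ∧ decode σ₁.onNormal = σ ∧
      ¬ Refuted s.inst κ σ ∧
      ∀ M : Marking B.domain (B.encColor (tokenColor X)), B.FlatEq s M →
        AuxAt M (guessed κ σ) → (encNet X).Ready M (.inl κ) σ₁ := by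
  classical
  set x := X t with hx
  obtain ⟨θ₀, hdec₀, hfact₀⟩ := x.exists_decode_eq σ
  obtain ⟨θ, hθ, r, hr, hrθ⟩ := (x.views s.inst θ₀).1 (hdec₀.symm ▸ h.2.1)
  obtain ⟨alt, rfl⟩ := List.get_of_mem hr
  obtain ⟨d, rfl, hrep, hrep', hpres⟩ := exists_choice x s.inst σ alt
  have hdec : decode θ = σ := by
    rw [← hdec₀]
    funext τ v
    exact (hθ _ _ fun h2 => by have := v.code_mod; omega).symm
  have hfact : ∀ f, x.varFact θ f = x.fact σ f := fun f => by
    rw [← hfact₀]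
    simp only [Unfolding.varFact]
    congr 1
    funext i
    exact (hθ _ _ fun h2 => by simp only [factVar] at h2; omega).symm
  refine ⟨⟨t, d⟩, .ofNormal θ, rfl, hdec, ?_, fun M hs hM => ?_⟩
  · rintro (⟨f, g, hfg, he⟩ | ⟨f, hf, hp, hI⟩)
    · exact hfg (hrep' f g he)
    · exact hp ((hpres f).2 ⟨hf, hI⟩)
  · refine (fireTrans_ready_iff hs hM).2 ⟨?_, hdec ▸ h.1, fun R => ?_, hrθ.1, hrθ.2.1⟩
    · have := (d.inTuple_fireVar_eq_tok_iff (σ₁ := .ofNormal θ)).2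
        ⟨fun f => (hfact _).trans ((hrep f).trans (by rw [Binding.onNormal_ofNormal, hdec])),
          hrθ.2.2⟩
      rwa [Binding.onNormal_ofNormal, hdec] at this
    · rw [Binding.onNormal_ofNormal]
      have hval : ∀ f, x.rel f = R → x.fact σ f =
          (⟨R, fun i => θ _ (factVar f i.1)⟩ : B.persistence.schema.Fact) := by
        rintro f rfl
        rw [← hfact]
        rfl
      refine (Multiset.le_iff_subset (Multiset.Nodup.map_on ?_ (Finset.nodup _))).2 ?_
      · intro f hf g hg hfg
        rw [Finset.mem_val, Finset.mem_filter] at hf hg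
        rw [← ((hpres f).1 hf.1).1, ← ((hpres g).1 hg.1).1]
        refine hrep' f g ?_
        rw [hval f hf.2, hval g hg.2, hfg]
      · intro a ha
        obtain ⟨f, hf, rfl⟩ := Multiset.mem_map.1 ha
        rw [Finset.mem_val, Finset.mem_filter] at hf
        refine ((hs.2 R).2 _).2 ?_
        rw [← hval f hf.2]
        exact ((hpres f).1 hf.1).2

/-- The labels of the encoding. -/
def encLabel : Key X ⊕ (Σ κ : Key X, κ.2.AuxOp) → Option B.control.Trans :=
  Sum.elim (fun κ => some κ.1) fun _ => none

/-- Every step of the DB-net is matched: the pending guess, if any, is withdrawn, the binding of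
the step is guessed, and the copy of the transition fires. -/
theorem Encodes.exists_weak_of_fires (hC : B.persistence.constraints = ∅) {s s' : B.Snapshot}
    {M : Marking B.domain (B.encColor (tokenColor X))} (h : Encodes s M) {t : B.control.Trans}
    {σ : B.domain.Binding} (hf : B.Fires s t σ s') (M₀) :
    ∃ M', ((encNet X).lts encLabel M₀).Weak M (some t) M' ∧ Encodes s' M' := by
  obtain ⟨M₁, hsil, hs₁, hM₁⟩ := h.exists_silent_idle (fun κ => κ.1) M₀
  obtain ⟨κ, σ₁, rfl, hdec, hr, hready⟩ := exists_fireTrans_of_enabled (X := X) hf.1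
  have hg : (encNet X).Enabled M₁ (.inr ⟨κ, .guess⟩) σ :=
    ⟨(auxTrans_ready_iff hM₁).2 ⟨eq_idle rfl, fun R w hw => absurd hw (Multiset.notMem_zero w)⟩,
      (freshFor_flowVars_guess hf.1.2.2).mono subset_rfl (hs₁.adom_subset_used hM₁)⟩
  have hprio : ∀ T σ', (encNet X).Enabled M₁ T σ' →
      (encNet X).prio T ≤ (encNet X).prio (.inr ⟨κ, .guess⟩) := by
    intro T σ' hT
    by_contra hp
    obtain ⟨κ', a, rfl, -, hp1⟩ := (refuted_of_enabled hs₁ hM₁ hT.1 (by omega)).1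
    have := congrArg Sigma.fst ((auxTrans_ready_iff hM₁).1 hT.1).1
    cases a
    · exact absurd hp1 zero_ne_one
    all_goals cases this
  obtain ⟨M₂, hstep, hs₂, hM₂⟩ := exists_silent_step hs₁ hM₁ hg hprio (fun κ => κ.1) M₀
  have hready₂ := hready M₂ hs₂ hM₂
  obtain ⟨M₃, hM₃⟩ := hready₂.exists_moves
  obtain ⟨h1, h2, h3⟩ := fireTrans_moves hs₂ hM₂ hr hready₂ hM₃
  refine ⟨M₃, ⟨M₂, M₃, hsil.tail hstep, ⟨.inl κ, σ₁, rfl, enabled_of_ready rfl hready₂,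
    prio_le_zero_of_not_refuted hs₂ hM₂ hr, hM₃⟩, .refl⟩, ⟨fun p => ?_, fun R => ?_⟩, .inl h3⟩
  · rcases hf.2 with ⟨-, -, hm⟩ | ⟨hn, -⟩
    · rw [hdec] at h1
      change ctrlPart M₃ p = s'.mark p
      exact add_right_cancel ((h1 p).trans (hm p).symm)
    · exact absurd (complies_of_constraints_eq_empty hC _) hn
  · rcases hf.2 with ⟨-, hi, -⟩ | ⟨hn, -⟩
    · rw [hdec] at h2
      rw [hi]
      exact h2 R
    · exact absurd (complies_of_constraints_eq_empty hC _) hn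

/-- A silent step of the encoding does not change the snapshot that is encoded. -/
theorem Encodes.of_auxTrans {s : B.Snapshot}
    {M M' : Marking B.domain (B.encColor (tokenColor X))} (h : Encodes s M) {κ : Key X}
    {a : κ.2.AuxOp} {σ : B.domain.Binding} (hf : (encNet X).Fires M (.inr ⟨κ, a⟩) σ M') :
    Encodes s M' := by
  obtain ⟨y, hM⟩ := h.exists_auxAt
  obtain ⟨h1, h2, h3⟩ := (auxTrans_moves_iff hM ((auxTrans_ready_iff hM).1 hf.1.1).1).1 hf.2.2
  refine ⟨h.1.of_parts_eq h1 h2, ?_⟩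
  have hidle : (auxTrans κ a).dst = none → AuxAt M' idle := fun hd =>
    eq_idle (y := ⟨(auxTrans κ a).dst, σ.outTuple (auxTrans κ a).dstInsc⟩) hd ▸ h3
  cases a with
  | guess =>
    exact .inr ⟨κ, σ, h3, hf.1.2.mono (outVars_subset_flowVars_guess κ) h.1.used_subset⟩
  | undo => exact .inl (hidle rfl)
  | clash => exact .inl (hidle rfl)
  | found => exact .inl (hidle rfl)

/-- Every visible step of the encoding is a step of the DB-net: since it respects the priorities, the
guess is not refuted. -/
theorem Encodes.exists_fires (hC : B.persistence.constraints = ∅) {s : B.Snapshot}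
    {M M' : Marking B.domain (B.encColor (tokenColor X))} (h : Encodes s M) {κ : Key X}
    {σ₁ : B.domain.Binding} (hf : (encNet X).Fires M (.inl κ) σ₁ M') :
    ∃ s' σ, B.Fires s κ.1 σ s' ∧ Encodes s' M' := by
  obtain ⟨hs, hM | ⟨κ', σ₀, hM, hfresh⟩⟩ := h
  · cases congrArg Sigma.fst
      ((EncTrans.ready_iff (e := encTrans X) (t := .inl κ) hM).1 hf.1.1).1
  · obtain rfl : κ = κ' := Option.some.inj (congrArg Sigma.fst
      ((EncTrans.ready_iff (e := encTrans X) (t := .inl κ) hM).1 hf.1.1).1)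
    obtain ⟨s', h1, h2⟩ := exists_fires_of_fireTrans hC hs hM hfresh
      (not_refuted_of_prio hs hM hf.2.1) hf.1.1 hf.2.2
    exact ⟨s', _, h1, h2⟩

theorem isWeakBisimulation_encodes (hC : B.persistence.constraints = ∅) (s₀ : B.Snapshot) (M₀) :
    LTS.IsWeakBisimulation (B.lts s₀) ((encNet X).lts encLabel M₀) Encodes := by
  intro s M h a
  constructor
  · rintro s' ⟨t, σ, rfl, hf⟩
    exact Encodes.exists_weak_of_fires hC h hf M₀
  · rintro M' ⟨κ | ⟨κ, a⟩, σ, rfl, hf⟩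
    · obtain ⟨s', σ', hf', h'⟩ := Encodes.exists_fires hC h hf
      exact ⟨s', ⟨s, s', .refl, ⟨κ.1, σ', rfl, hf'⟩, .refl⟩, h'⟩
    · exact ⟨s, .refl, Encodes.of_auxTrans h hf⟩

open scoped Classical in
/-- The initial marking of the encoding. -/
noncomputable def encMark (X : ∀ t, B.Unfolding t) (s : B.Snapshot) :
    Marking B.domain (B.encColor (tokenColor X))
  | .inl p => s.mark p
  | .inr (.inl R) => (s.inst.preimage (Sigma.mk R) sigma_mk_injective.injOn).val
  | .inr (.inr none) => ({fun i => i.elim0} : Multiset (B.domain.Tuple (tokenColor X none)))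
  | .inr (.inr (some _)) => 0

theorem encodes_encMark (s : B.Snapshot) : Encodes s (encMark X s) :=
  ⟨⟨fun _ => rfl, fun _ => ⟨Finset.nodup _, fun _ => Finset.mem_preimage⟩⟩, .inl <|
    auxAt_of_forall rfl fun
      | none, h => absurd rfl h
      | some _, _ => rfl⟩

end DBNet

theorem theorem1 (B : DBNet.{u}) (hC : B.persistence.constraints = ∅)
    (hQ : ∀ q : B.logic.Qry, (B.logic.query q).body.IsUCQF) (s₀ : B.Snapshot) :
    ∃ (PAux TVis TAux : Type) (auxColor : PAux → B.domain.Color)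
      (orig : TVis → B.control.Trans)
      (N : PrioNuCPN B.domain (B.encColor auxColor) (TVis ⊕ TAux))
      (M₀ : Marking B.domain (B.encColor auxColor)),
      Function.Surjective orig ∧
      LTS.WeaklyBisimilarWith (B.lts s₀)
        (N.lts (Sum.elim (fun t => some (orig t)) (fun _ => none)) M₀)
        (fun s M => B.FlatEq s M) := by
  have X : ∀ t, B.Unfolding t := fun t => Classical.choice (B.nonempty_unfolding hQ t)
  exact ⟨Option (DBNet.Key X), DBNet.Key X, Σ κ : DBNet.Key X, κ.2.AuxOp, DBNet.tokenColor X,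
    fun κ => κ.1, DBNet.encNet X, DBNet.encMark X s₀,
    fun t => ⟨⟨t, Classical.arbitrary _⟩, rfl⟩, DBNet.Encodes,
    DBNet.isWeakBisimulation_encodes hC s₀ _, fun _ _ h => h.1, DBNet.encodes_encMark s₀⟩
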